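/- **Setting.** Let $n,l\ge 1$ be integers, let $p^0,p^1,\dots,p^{l+1}\ge 1$ be integers (layer widths), and write $m:=p^{l+1}$, $\underline p:=\max_{1\le j\le l}p^j$, $\overline p:=\sum_{j=0}^{l}p^{j+1}p^j$. For $j\in\{1,\dots,l\}$ let $\boldsymbol f^j:\mathbb R^{p^j}\to\mathbb R^{p^j}$ be $1$-Lipschitz with respect to the Euclidean norm with $\boldsymbol f^j[\mathbf 0]=\mathbf 0$. For matrices $\Theta^j\in\mathbb R^{p^{j+1}\times p^j}$, $j\in\{0,\dots,l-1\}$, and $\overline{\boldsymbol\Theta}=(\Theta^{l-1},\dots,\Theta^0)$, put $$\overline{\boldsymbol g}_{\overline{\boldsymbol\Theta}}[\boldsymbol x]:=\boldsymbol f^l\bigl[\Theta^{l-1}\cdots\boldsymbol f^1[\Theta^0\boldsymbol x]\bigr]\in\mathbb R^{p^l}\qquad(\boldsymbol x\in\mathbb R^{p^0}).$$ For a matrix $A$ let $\|A\|_1:=\sum_{i,k}|A_{ik}|$, $\|A\|_{2,1}:=\sum_k\sqrt{\sum_i|A_{ik}|^2}$ and $\|A\|_\infty:=\max_{i,k}|A_{ik}|$,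 and let $$\overline{\mathcal M}_1:=\bigl\{\overline{\boldsymbol\Theta}:\max_{0\le j\le l-1}\|\Theta^j\|_1\le1\bigr\},\qquad \overline{\mathcal M}_{2,1}:=\bigl\{\overline{\boldsymbol\Theta}:\max_{0\le j\le l-1}\|\Theta^j\|_{2,1}\le1\bigr\}.$$ Let $\boldsymbol x_1,\dots,\boldsymbol x_n\in\mathbb R^{p^0}$ be fixed, with $\overline v_\infty:=\sqrt{\frac1n\sum_{i=1}^n\|\boldsymbol x_i\|_\infty^2}$ and $\overline v_2:=\sqrt{\frac1n\sum_{i=1}^n\|\boldsymbol x_i\|_2^2}$. Let $\boldsymbol u_1,\dots,\boldsymbol u_n$ be independent, centred random vectors in $\mathbb R^m$ whose entries are uniformly subgaussian with parameters $K,\sigma_0\in(0,\infty)$, that is, $$K^2\bigl(E\,e^{(\boldsymbol u_i)_a^2/K^2}-1\bigr)\le\sigma_0^2\qquad\text{for all }i\in\{1,\dots,n\},\ a\in\{1,\dots,m\}$$ (the entries of one vector may be dependent). Define the effective noises $$r^*_{\mathrm{con}}:=2\sup_{\overline{\boldsymbol\Theta}\in\overline{\mathcal M}_1}\Bigl\|\sum_{i=1}^n\boldsymbol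 u_i\bigl(\overline{\boldsymbol g}_{\overline{\boldsymbol\Theta}}[\boldsymbol x_i]\bigr)^\top\Bigr\|_\infty,\qquad r^*_{\mathrm{node}}:=2\sqrt m\sup_{\overline{\boldsymbol\Theta}\in\overline{\mathcal M}_{2,1}}\Bigl\|\sum_{i=1}^n\boldsymbol u_i\bigl(\overline{\boldsymbol g}_{\overline{\boldsymbol\Theta}}[\boldsymbol x_i]\bigr)^\top\Bigr\|_\infty .$$ **Proposition (Subgaussian Noise).** For all $K,\sigma_0\in(0,\infty)$ there is a constant $c\in(0,\infty)$, depending only on $K$ and $\sigma_0$, such that in every setting as above $$P\Bigl\{r^*_{\mathrm{con}}\le c\,\overline v_\infty\sqrt{n\,l\,(\log[2mn\overline p])^3}\Bigr\}\ge1-\frac1n$$ and $$P\Bigl\{r^*_{\mathrm{node}}\le c\,\overline v_2\sqrt{m\,n\,l\,\underline p\,(\log[2mn\overline p])^3}\Bigr\}\ge1-\frac1n .$$ -/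

import Mathlib

open MeasureTheory ProbabilityTheory
open scoped ENNReal

namespace SparseNet

/-- The inner parameters `(Θ^{l-1}, …, Θ^0)` of a network with layer widths `p 0, …, p l`:
`Θ^j` is a real `p (j+1) × p j` matrix. -/
abbrev InnerParam (l : ℕ) (p : ℕ → ℕ) : Type :=
  ∀ j : Fin l, Matrix (Fin (p (j + 1))) (Fin (p j)) ℝ

/-- The activation functions; the entry with index `j : Fin l` is `f^{j+1}`, a map of
`ℝ^{p (j+1)}` into itself (not necessarily acting entry by entry). -/
abbrev Activations (l : ℕ) (p : ℕ → ℕ) : Type :=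
  ∀ j : Fin l, EuclideanSpace ℝ (Fin (p (j + 1))) → EuclideanSpace ℝ (Fin (p (j + 1)))

/-- The output `f^j[Θ^{j-1} ⋯ f^1[Θ^0 x]]` of the `j`-th hidden layer, for `j ≤ l`
(the input itself for `j = 0`). -/
noncomputable def layer {l : ℕ} {p : ℕ → ℕ} (f : Activations l p) (Θ : InnerParam l p)
    (x : EuclideanSpace ℝ (Fin (p 0))) :
    (j : ℕ) → j ≤ l → EuclideanSpace ℝ (Fin (p j))
  | 0, _ => x
  | j + 1, h =>
      f ⟨j, h⟩ (WithLp.toLp 2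
        (Matrix.mulVec (Θ ⟨j, h⟩) (WithLp.ofLp (layer f Θ x j (Nat.le_of_succ_le h)))))

/-- The network without its outermost linear layer,
`x ↦ f^l[Θ^{l-1} ⋯ f^1[Θ^0 x]] ∈ ℝ^{p l}`. -/
noncomputable def innerNet {l : ℕ} {p : ℕ → ℕ} (f : Activations l p) (Θ : InnerParam l p)
    (x : EuclideanSpace ℝ (Fin (p 0))) : EuclideanSpace ℝ (Fin (p l)) :=
  layer f Θ x l le_rfl

/-- The `ℓ₁`-norm of a matrix: the sum of the absolute values of its entries. -/
def normOne {a b : ℕ} (A : Matrix (Fin a) (Fin b) ℝ) : ℝ :=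
  ∑ i, ∑ k, |A i k|

/-- The `ℓ₂/ℓ₁`-norm of a matrix: the sum of the Euclidean norms of its columns. -/
noncomputable def normTwoOne {a b : ℕ} (A : Matrix (Fin a) (Fin b) ℝ) : ℝ :=
  ∑ k, Real.sqrt (∑ i, |A i k| ^ 2)

/-- The entrywise maximum norm of a matrix. -/
noncomputable def normMax {a b : ℕ} (A : Matrix (Fin a) (Fin b) ℝ) : ℝ :=
  ⨆ i, ⨆ k, |A i k|

/-- Inner parameters with all layers in the unit ball of the `ℓ₁`-norm. -/
def conSet (l : ℕ) (p : ℕ → ℕ) : Set (InnerParam l p) :=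
  {Θ | ∀ j, normOne (Θ j) ≤ 1}

/-- Inner parameters with all layers in the unit ball of the `ℓ₂/ℓ₁`-norm. -/
def nodeSet (l : ℕ) (p : ℕ → ℕ) : Set (InnerParam l p) :=
  {Θ | ∀ j, normTwoOne (Θ j) ≤ 1}

/-- The `m × p l` matrix `∑ i, u_i (g_Θ(x_i))ᵀ` for noise vectors `u_i ∈ ℝ^m`. -/
noncomputable def noiseMatrix {n l m : ℕ} {p : ℕ → ℕ} (f : Activations l p)
    (x : Fin n → EuclideanSpace ℝ (Fin (p 0))) (u : Fin n → EuclideanSpace ℝ (Fin m))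
    (Θ : InnerParam l p) : Matrix (Fin m) (Fin (p l)) ℝ :=
  ∑ i, Matrix.vecMulVec (WithLp.ofLp (u i)) (WithLp.ofLp (innerNet f Θ (x i)))

/-- The effective noise of connection-sparse networks. The supremum is taken in `[0, ∞]`,
so that a bound for it by a real number includes its finiteness. -/
noncomputable def rCon {n l m : ℕ} {p : ℕ → ℕ} (f : Activations l p)
    (x : Fin n → EuclideanSpace ℝ (Fin (p 0))) (u : Fin n → EuclideanSpace ℝ (Fin m)) : ℝ≥0∞ :=
  2 * ⨆ Θ ∈ conSet l p, ENNReal.ofReal (normMax (noiseMatrix f x u Θ))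

/-- The effective noise of node-sparse networks. -/
noncomputable def rNode {n l m : ℕ} {p : ℕ → ℕ} (f : Activations l p)
    (x : Fin n → EuclideanSpace ℝ (Fin (p 0))) (u : Fin n → EuclideanSpace ℝ (Fin m)) : ℝ≥0∞ :=
  2 * ENNReal.ofReal (Real.sqrt m) *
    ⨆ Θ ∈ nodeSet l p, ENNReal.ofReal (normMax (noiseMatrix f x u Θ))

/-- The maximal width of the hidden layers, `max {p 1, …, p l}`. -/
def maxWidth (l : ℕ) (p : ℕ → ℕ) : ℕ := (Finset.Icc 1 l).sup p

/-- The total number of parameters of the full network, `∑_{j=0}^{l} p (j+1) * p j`. -/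
def numParams (l : ℕ) (p : ℕ → ℕ) : ℕ := ∑ j ∈ Finset.range (l + 1), p (j + 1) * p j

/-- Quadratic mean of the maximum norms of the inputs (the norm of the underlying function
`Fin d → ℝ` is the maximum norm). -/
noncomputable def vInf {n d : ℕ} (x : Fin n → EuclideanSpace ℝ (Fin d)) : ℝ :=
  Real.sqrt ((1 / (n : ℝ)) * ∑ i, ‖WithLp.ofLp (x i)‖ ^ 2)

/-- Quadratic mean of the Euclidean norms of the inputs. -/
noncomputable def vTwo {n d : ℕ} (x : Fin n → EuclideanSpace ℝ (Fin d)) : ℝ :=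
  Real.sqrt ((1 / (n : ℝ)) * ∑ i, ‖x i‖ ^ 2)

/-- All entries `w` of the random vectors satisfy `K² (E exp(w² / K²) - 1) ≤ σ₀²`, with a
finite expectation. -/
def UniformlySubgaussian {Ω : Type*} [MeasurableSpace Ω] {n m : ℕ} (K σ₀ : ℝ) (P : Measure Ω)
    (u : Fin n → Ω → EuclideanSpace ℝ (Fin m)) : Prop :=
  ∀ i a, Integrable (fun ω => Real.exp ((u i ω a) ^ 2 / K ^ 2)) P ∧
    K ^ 2 * ((∫ ω, Real.exp ((u i ω a) ^ 2 / K ^ 2) ∂P) - 1) ≤ σ₀ ^ 2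

end SparseNet

/-! Both effective noises are suprema of weighted sums of subgaussian variables over a class of
networks, so chaining applies. Let B be the Euclidean norm of the vector of the maximum norms of the
inputs and Q = 2mn times the number of parameters. Put q = 1 for connection sparsity and let q be
the maximal hidden width for node sparsity. The class has a net at scale B/2^t whose cardinality has
logarithm of order 4^t l q log Q. Links at scale t then fluctuate, up to constants, by 2^t sqrt(l q
log Q) times a distance B/2^t. Every scale thus costs the same, and about log Q scales suffice
before a trivial bound finishes. The total is B sqrt(l q (log Q)^3).

The delicate point is the dependence on the depth. Changing the layers one at a time bounds the
output distance by sqrt l times the norm of the linear map `gainVec`, whose values at single-entry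
parameters have norm at most B. Maurey's approximation (`exists_sparse_approx`) covers the image of
an ℓ₁-ball, but the ℓ₁-norms of l layers may add up to l, which would cost extra powers of l. The
remedy is a trade-off in the deficit δ = 1 - ‖Θ^j‖_F. The layer contracts by at least e^{-δ}. It
also lies, up to rounding, within ℓ₁-distance 4δ sqrt q of a finite set of centres: signed unit
entries, or matrices with a single column on a grid. With the centres fixed, the remaining ℓ₁-radius
is of order sqrt q (1 + E), where E is the sum of the deficits, and the contraction e^{-E} absorbs
it. `exists_net` carries this out, and `one_sub_le_measureReal_noise_le` does the chaining. -/

namespace SparseNet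

/-! ### Matrix norms and their action on vectors. -/

/-- The Frobenius norm of a matrix. -/
noncomputable def frob {a b : ℕ} (A : Matrix (Fin a) (Fin b) ℝ) : ℝ :=
  Real.sqrt (∑ i, ∑ k, A i k ^ 2)

lemma frob_nonneg {a b : ℕ} (A : Matrix (Fin a) (Fin b) ℝ) : 0 ≤ frob A := Real.sqrt_nonneg _

lemma frob_sq {a b : ℕ} (A : Matrix (Fin a) (Fin b) ℝ) : frob A ^ 2 = ∑ i, ∑ k, A i k ^ 2 :=
  Real.sq_sqrt (Finset.sum_nonneg fun _ _ => Finset.sum_nonneg fun _ _ => sq_nonneg _)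

/-- The Euclidean norm of the column `k` of a matrix. -/
noncomputable def colNorm {a b : ℕ} (A : Matrix (Fin a) (Fin b) ℝ) (k : Fin b) : ℝ :=
  Real.sqrt (∑ i, |A i k| ^ 2)

lemma colNorm_nonneg {a b : ℕ} (A : Matrix (Fin a) (Fin b) ℝ) (k : Fin b) : 0 ≤ colNorm A k :=
  Real.sqrt_nonneg _

lemma colNorm_sq {a b : ℕ} (A : Matrix (Fin a) (Fin b) ℝ) (k : Fin b) :
    colNorm A k ^ 2 = ∑ i, A i k ^ 2 := by
  rw [colNorm, Real.sq_sqrt (Finset.sum_nonneg fun _ _ => sq_nonneg _)]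
  simp

lemma colNorm_eq_norm {a b : ℕ} (A : Matrix (Fin a) (Fin b) ℝ) (k : Fin b) :
    colNorm A k = ‖WithLp.toLp 2 (fun i => A i k)‖ := by
  rw [EuclideanSpace.norm_eq]; simp [colNorm]

lemma frob_sq_eq_sum_colNorm {a b : ℕ} (A : Matrix (Fin a) (Fin b) ℝ) :
    frob A ^ 2 = ∑ k, colNorm A k ^ 2 := by
  rw [frob_sq, Finset.sum_comm]
  simp [colNorm_sq]

lemma normTwoOne_eq {a b : ℕ} (A : Matrix (Fin a) (Fin b) ℝ) :
    normTwoOne A = ∑ k, colNorm A k := rfl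

lemma frob_le_normTwoOne {a b : ℕ} (A : Matrix (Fin a) (Fin b) ℝ) : frob A ≤ normTwoOne A := by
  refine le_of_sq_le_sq ?_ (Finset.sum_nonneg fun k _ => colNorm_nonneg A k)
  rw [frob_sq_eq_sum_colNorm, normTwoOne_eq]
  exact Finset.sum_sq_le_sq_sum_of_nonneg fun k _ => colNorm_nonneg A k

lemma colNorm_le_sum_abs {a b : ℕ} (A : Matrix (Fin a) (Fin b) ℝ) (k : Fin b) :
    colNorm A k ≤ ∑ i, |A i k| :=
  Real.sqrt_le_iff.2 ⟨Finset.sum_nonneg fun _ _ => abs_nonneg _,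
    Finset.sum_sq_le_sq_sum_of_nonneg fun _ _ => abs_nonneg _⟩

lemma normTwoOne_le_normOne {a b : ℕ} (A : Matrix (Fin a) (Fin b) ℝ) :
    normTwoOne A ≤ normOne A := by
  rw [normOne, Finset.sum_comm, normTwoOne_eq]
  exact Finset.sum_le_sum fun k _ => colNorm_le_sum_abs A k

lemma conSet_subset_nodeSet (l : ℕ) (p : ℕ → ℕ) : conSet l p ⊆ nodeSet l p :=
  fun Θ h j => (normTwoOne_le_normOne (Θ j)).trans (h j)

lemma sum_abs_le_sqrt_mul_colNorm {a b : ℕ} (A : Matrix (Fin a) (Fin b) ℝ) (k : Fin b) :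
    ∑ i, |A i k| ≤ Real.sqrt a * colNorm A k := by
  rw [colNorm, ← Real.sqrt_mul (Nat.cast_nonneg a)]
  refine Real.le_sqrt_of_sq_le ?_
  simpa using sq_sum_le_card_mul_sum_sq (s := Finset.univ) (f := fun i => |A i k|)

lemma norm_mulVec_le_frob {a b : ℕ} (A : Matrix (Fin a) (Fin b) ℝ)
    (z : EuclideanSpace ℝ (Fin b)) :
    ‖WithLp.toLp 2 (Matrix.mulVec A (WithLp.ofLp z))‖ ≤ frob A * ‖z‖ := by
  refine le_of_sq_le_sq ?_ (mul_nonneg (frob_nonneg A) (norm_nonneg z))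
  rw [mul_pow, frob_sq, EuclideanSpace.norm_sq_eq, EuclideanSpace.norm_sq_eq, Finset.sum_mul]
  refine Finset.sum_le_sum fun i _ => ?_
  simp only [Real.norm_eq_abs, sq_abs, Matrix.mulVec, dotProduct]
  exact Finset.sum_mul_sq_le_sq_mul_sq _ _ _

/-- The product is a combination of the columns of the matrix. In the first layer this turns the
maximum norm of the input into a Euclidean norm, so inputs enter only through their maximum norms,
even under node sparsity. -/
lemma norm_mulVec_le_normTwoOne {a b : ℕ} (A : Matrix (Fin a) (Fin b) ℝ) (w : Fin b → ℝ) :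
    ‖WithLp.toLp 2 (Matrix.mulVec A w)‖ ≤ normTwoOne A * ‖w‖ := by
  have h : WithLp.toLp 2 (Matrix.mulVec A w)
      = ∑ k, w k • (WithLp.toLp 2 (fun i => A i k) : EuclideanSpace ℝ (Fin a)) := by
    ext i
    simp [Matrix.mulVec, dotProduct, mul_comm]
  rw [h, normTwoOne_eq, Finset.sum_mul]
  refine (norm_sum_le _ _).trans (Finset.sum_le_sum fun k _ => ?_)
  rw [norm_smul, ← colNorm_eq_norm, mul_comm]
  exact mul_le_mul_of_nonneg_left (norm_le_pi_norm w k) (colNorm_nonneg A k)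

/-! ### Perturbation of the network output by its parameters. -/

variable {l : ℕ} {p : ℕ → ℕ}

/-- The size of the change of layer `j` caused by the parameter perturbation `Δ`, for the
input `x`. -/
noncomputable def gain (x : EuclideanSpace ℝ (Fin (p 0))) (Δ : InnerParam l p) (j : Fin l) : ℝ :=
  -- The input is padded by zeros because `p j` and `p 0` agree only propositionally in this branch;
  -- the padding is never reached.
  if (j : ℕ) = 0 then
    Real.sqrt (∑ a : Fin (p (j + 1)), (∑ k : Fin (p j), Δ j a k *
      (if h : (k : ℕ) < p 0 then x ⟨k, h⟩ else 0)) ^ 2)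
  else frob (Δ j) * ‖WithLp.ofLp x‖

lemma gain_zero (x : EuclideanSpace ℝ (Fin (p 0))) (Δ : InnerParam l p) (h : 0 < l) :
    gain x Δ ⟨0, h⟩ = ‖WithLp.toLp 2 (Matrix.mulVec (Δ ⟨0, h⟩) (WithLp.ofLp x))‖ := by
  rw [EuclideanSpace.norm_eq, gain, if_pos rfl]
  simp [Matrix.mulVec, dotProduct]

lemma gain_succ (x : EuclideanSpace ℝ (Fin (p 0))) (Δ : InnerParam l p) (j : ℕ) (h : j + 1 < l) :
    gain x Δ ⟨j + 1, h⟩ = frob (Δ ⟨j + 1, h⟩) * ‖WithLp.ofLp x‖ := by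
  simp [gain]

lemma gain_nonneg (x : EuclideanSpace ℝ (Fin (p 0))) (Δ : InnerParam l p) (j : Fin l) :
    0 ≤ gain x Δ j := by
  unfold gain
  split_ifs
  · positivity
  · exact mul_nonneg (frob_nonneg _) (norm_nonneg _)

lemma norm_activation_sub_le {f : Activations l p} (hf : ∀ j, LipschitzWith 1 (f j)) (j : Fin l)
    (y z : EuclideanSpace ℝ (Fin (p (j + 1)))) : ‖f j y - f j z‖ ≤ ‖y - z‖ := by
  simpa [dist_eq_norm] using (hf j).dist_le_mul y z

lemma norm_activation_le {f : Activations l p} (hf : ∀ j, LipschitzWith 1 (f j))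
    (hf0 : ∀ j, f j 0 = 0) (j : Fin l) (y : EuclideanSpace ℝ (Fin (p (j + 1)))) :
    ‖f j y‖ ≤ ‖y‖ := by
  simpa [hf0] using norm_activation_sub_le hf j y 0

lemma layer_zero_param {f : Activations l p} (hf0 : ∀ j, f j 0 = 0)
    (x : EuclideanSpace ℝ (Fin (p 0))) (j : ℕ) (hj : j + 1 ≤ l) :
    layer f 0 x (j + 1) hj = 0 := by
  simp [layer, hf0]

/-- The layers of a network whose `j`-th Frobenius norm is at most `exp (-e j)`. -/
lemma norm_layer_succ_le {f : Activations l p} (hf : ∀ j, LipschitzWith 1 (f j))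
    (hf0 : ∀ j, f j 0 = 0) {Θ : InnerParam l p} (hΘ : Θ ∈ nodeSet l p) (e : ℕ → ℝ)
    (he : ∀ j, e j ≤ 1) (hΘe : ∀ j : Fin l, frob (Θ j) ≤ Real.exp (-e j))
    (x : EuclideanSpace ℝ (Fin (p 0))) (j : ℕ) (hj : j + 1 ≤ l) :
    ‖layer f Θ x (j + 1) hj‖
      ≤ Real.exp (1 - ∑ i ∈ Finset.range (j + 1), e i) * ‖WithLp.ofLp x‖ := by
  induction j with
  | zero =>
    rw [layer]
    -- The Frobenius norm does not control a map from the maximum norm to the Euclidean norm. The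
    -- first layer therefore contributes the factor 1, which the extra 1 in the exponent covers.
    refine (norm_activation_le hf hf0 _ _).trans ((norm_mulVec_le_normTwoOne _ _).trans ?_)
    refine mul_le_mul_of_nonneg_right ((hΘ _).trans ?_) (norm_nonneg _)
    rw [Real.one_le_exp_iff]
    simpa using he 0
  | succ j ih =>
    rw [layer]
    refine (norm_activation_le hf hf0 _ _).trans ((norm_mulVec_le_frob _ _).trans ?_)
    refine (mul_le_mul (hΘe _) (ih (Nat.le_of_succ_le hj)) (norm_nonneg _)
      (Real.exp_pos _).le).trans_eq ?_
    rw [← mul_assoc, ← Real.exp_add, Finset.sum_range_succ _ (j + 1)]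
    congr 2
    ring

/-- The layers are exchanged one at a time. Each exchange is contracted by all other layers, except
possibly the first. The factors of the exchanged layer and of the first layer are missing from the
product, and each costs at most e since `e j ≤ 1`; hence the 2 in the exponent. -/
lemma norm_layer_sub_le {f : Activations l p} (hf : ∀ j, LipschitzWith 1 (f j))
    (hf0 : ∀ j, f j 0 = 0) {Θ Γ : InnerParam l p} (hΓ : Γ ∈ nodeSet l p)
    (e : ℕ → ℝ) (he : ∀ j, e j ≤ 1) (hΘe : ∀ j : Fin l, frob (Θ j) ≤ Real.exp (-e j))
    (hΓe : ∀ j : Fin l, frob (Γ j) ≤ Real.exp (-e j))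
    (x : EuclideanSpace ℝ (Fin (p 0))) (j : ℕ) (hj : j ≤ l) :
    ‖layer f Θ x j hj - layer f Γ x j hj‖
      ≤ Real.exp (2 - ∑ i ∈ Finset.range j, e i)
        * ∑ i : Fin j, gain x (Θ - Γ) (Fin.castLE hj i) := by
  induction j with
  | zero => simp [layer]
  | succ j ih =>
    have hj' := Nat.le_of_succ_le hj
    have key : ‖layer f Θ x (j + 1) hj - layer f Γ x (j + 1) hj‖
        ≤ frob (Θ ⟨j, hj⟩) * ‖layer f Θ x j hj' - layer f Γ x j hj'‖
          + ‖WithLp.toLp 2 (Matrix.mulVec ((Θ - Γ) ⟨j, hj⟩) (WithLp.ofLp (layer f Γ x j hj')))‖ := by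
      rw [layer, layer]
      refine (norm_activation_sub_le hf _ _ _).trans ?_
      refine le_trans (le_of_eq ?_) ((norm_add_le _ _).trans
        (add_le_add_left (norm_mulVec_le_frob (Θ ⟨j, hj⟩)
          (layer f Θ x j hj' - layer f Γ x j hj')) _))
      rw [← WithLp.toLp_sub, ← WithLp.toLp_add]
      simp [Matrix.mulVec_sub, Matrix.sub_mulVec]
    refine key.trans ?_
    rw [Fin.sum_univ_castSucc, mul_add]
    have hexp : Real.exp (2 - ∑ i ∈ Finset.range (j + 1), e i)
        = Real.exp (-e j) * Real.exp (2 - ∑ i ∈ Finset.range j, e i) := by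
      rw [← Real.exp_add, Finset.sum_range_succ]; congr 1; ring
    refine add_le_add ?_ ?_
    · rw [hexp, mul_assoc]
      exact mul_le_mul (hΘe ⟨j, hj⟩) (ih hj') (norm_nonneg _) (Real.exp_pos _).le
    · rcases j with _ | j
      · have : Fin.castLE hj (Fin.last 0) = ⟨0, hj⟩ := rfl
        rw [this, gain_zero]
        refine le_mul_of_one_le_left (norm_nonneg _) ?_
        rw [Real.one_le_exp_iff]
        have := he 0
        simp only [zero_add, Finset.range_one, Finset.sum_singleton]; linarith
      · have : Fin.castLE hj (Fin.last (j + 1)) = ⟨j + 1, hj⟩ := rfl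
        rw [this, gain_succ]
        refine (norm_mulVec_le_frob _ _).trans ?_
        rw [mul_left_comm]
        refine mul_le_mul_of_nonneg_left ?_ (frob_nonneg _)
        refine (norm_layer_succ_le hf hf0 hΓ e he hΓe x j hj').trans ?_
        refine mul_le_mul_of_nonneg_right (Real.exp_le_exp.2 ?_) (norm_nonneg _)
        rw [Finset.sum_range_succ _ (j + 1)]
        linarith [he (j + 1)]

lemma norm_innerNet_le {f : Activations l p} (hf : ∀ j, LipschitzWith 1 (f j))
    (hf0 : ∀ j, f j 0 = 0) (hl : 0 < l) {Θ : InnerParam l p} (hΘ : Θ ∈ nodeSet l p)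
    (x : EuclideanSpace ℝ (Fin (p 0))) : ‖innerNet f Θ x‖ ≤ ‖WithLp.ofLp x‖ := by
  have key : ∀ (j : ℕ) (hj : j + 1 ≤ l), ‖layer f Θ x (j + 1) hj‖ ≤ ‖WithLp.ofLp x‖ := by
    intro j hj
    induction j with
    | zero =>
      rw [layer]
      refine (norm_activation_le hf hf0 _ _).trans ((norm_mulVec_le_normTwoOne _ _).trans ?_)
      exact mul_le_of_le_one_left (norm_nonneg _) (hΘ _)
    | succ j ih =>
      rw [layer]
      refine (norm_activation_le hf hf0 _ _).trans ((norm_mulVec_le_frob _ _).trans ?_)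
      exact (mul_le_of_le_one_left (norm_nonneg _)
        ((frob_le_normTwoOne _).trans (hΘ _))).trans (ih (Nat.le_of_succ_le hj))
  obtain ⟨j, rfl⟩ := Nat.exists_eq_succ_of_ne_zero hl.ne'
  exact key j le_rfl

lemma innerNet_zero_param {f : Activations l p} (hf0 : ∀ j, f j 0 = 0) (hl : 0 < l)
    (x : EuclideanSpace ℝ (Fin (p 0))) : innerNet f 0 x = 0 := by
  obtain ⟨j, rfl⟩ := Nat.exists_eq_succ_of_ne_zero hl.ne'
  exact layer_zero_param hf0 x j le_rfl

/-- The Euclidean distance of the outputs of two networks on the inputs `x 0, …, x (n-1)`. -/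
noncomputable def netDist {n : ℕ} (f : Activations l p) (x : Fin n → EuclideanSpace ℝ (Fin (p 0)))
    (Θ Γ : InnerParam l p) : ℝ :=
  Real.sqrt (∑ i, ‖innerNet f Θ (x i) - innerNet f Γ (x i)‖ ^ 2)

/-- The Euclidean norm of the vector of the maximum norms of the inputs. -/
noncomputable def inputSize {n d : ℕ} (x : Fin n → EuclideanSpace ℝ (Fin d)) : ℝ :=
  Real.sqrt (∑ i, ‖WithLp.ofLp (x i)‖ ^ 2)

/-- Cauchy–Schwarz over the layers replaces a sum of gains by a Hilbert norm, which Maurey's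
argument needs, at the price of sqrt l. -/
lemma netDist_le {n : ℕ} {f : Activations l p} (hf : ∀ j, LipschitzWith 1 (f j))
    (hf0 : ∀ j, f j 0 = 0) {Θ Γ : InnerParam l p} (hΓ : Γ ∈ nodeSet l p)
    (e : Fin l → ℝ) (he : ∀ j, e j ≤ 1) (hΘe : ∀ j, frob (Θ j) ≤ Real.exp (-e j))
    (hΓe : ∀ j, frob (Γ j) ≤ Real.exp (-e j)) (x : Fin n → EuclideanSpace ℝ (Fin (p 0))) :
    netDist f x Θ Γ ≤ Real.exp (2 - ∑ j, e j) *
      (Real.sqrt l * Real.sqrt (∑ i, ∑ j, gain (x i) (Θ - Γ) j ^ 2)) := by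
  set E : ℕ → ℝ := fun j => if h : j < l then e ⟨j, h⟩ else 0 with hE
  have hEe : ∀ j : Fin l, E j = e j := fun j => by simp [hE]
  have hsum : ∑ i ∈ Finset.range l, E i = ∑ j, e j := by
    rw [← Fin.sum_univ_eq_sum_range]; simp [hEe]
  have hE1 : ∀ j, E j ≤ 1 := by
    intro j
    simp only [hE]
    split_ifs
    · exact he _
    · exact zero_le_one
  have h : ∀ i, ‖innerNet f Θ (x i) - innerNet f Γ (x i)‖
      ≤ Real.exp (2 - ∑ j, e j) * ∑ j, gain (x i) (Θ - Γ) j := by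
    intro i
    have := norm_layer_sub_le hf hf0 hΓ E hE1 (by simpa [hEe] using hΘe)
      (by simpa [hEe] using hΓe) (x i) l le_rfl
    rw [hsum] at this
    exact this
  rw [netDist, ← Real.sqrt_mul (Nat.cast_nonneg l)]
  refine Real.sqrt_le_iff.2 ⟨by positivity, ?_⟩
  rw [mul_pow, Real.sq_sqrt (by positivity), Finset.mul_sum, Finset.mul_sum]
  refine Finset.sum_le_sum fun i _ => ?_
  refine (pow_le_pow_left₀ (norm_nonneg _) (h i) 2).trans ?_
  rw [mul_pow]
  refine mul_le_mul_of_nonneg_left ?_ (by positivity)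
  simpa using sq_sum_le_card_mul_sum_sq (s := Finset.univ) (f := gain (x i) (Θ - Γ))

end SparseNet

namespace SparseNet

/-! ### Maurey's sparse approximation in a Hilbert space. -/

section SparseApproximation

variable {V E : Type*} [NormedAddCommGroup V] [InnerProductSpace ℝ V]

lemma norm_signed_vertex_le (φ : E → V) {R B : ℝ} (hR : 0 ≤ R) (hB : ∀ e, ‖φ e‖ ≤ B)
    (v : E × SignType) : ‖(R * (v.2 : ℝ)) • φ v.1‖ ≤ R * B := by
  have hs : |(v.2 : ℝ)| ≤ 1 := by rcases v with ⟨e, s⟩; cases s <;> simp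
  rw [norm_smul, Real.norm_eq_abs, abs_mul, abs_of_nonneg hR]
  exact mul_le_mul (mul_le_of_le_one_right hR hs) (hB _) (norm_nonneg _) hR

variable [Fintype E]

/-- A linear functional on a scaled absolutely convex hull is maximal at a signed vertex: the one
with the largest absolute inner product. -/
lemma exists_signed_vertex_inner_ge [Nonempty E] (φ : E → V) (a : E → ℝ) {R : ℝ}
    (ha : ∑ e, |a e| ≤ R) (y : V) :
    ∃ v : E × SignType, inner ℝ y (∑ e, a e • φ e) ≤ inner ℝ y ((R * (v.2 : ℝ)) • φ v.1) := by
  obtain ⟨e₀, -, h₀⟩ := Finset.exists_max_image Finset.univ (fun e => |inner ℝ y (φ e)|)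
    Finset.univ_nonempty
  refine ⟨(e₀, SignType.sign (inner ℝ y (φ e₀))), ?_⟩
  rw [inner_sum, inner_smul_right, mul_assoc, sign_mul_self]
  calc ∑ e, inner ℝ y (a e • φ e) ≤ ∑ e, |a e| * |inner ℝ y (φ e₀)| := by
        refine Finset.sum_le_sum fun e _ => ?_
        rw [inner_smul_right]
        refine (le_abs_self _).trans ?_
        rw [abs_mul]
        exact mul_le_mul_of_nonneg_left (h₀ e (Finset.mem_univ _)) (abs_nonneg _)
    _ ≤ R * |inner ℝ y (φ e₀)| := by
        rw [← Finset.sum_mul]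
        exact mul_le_mul_of_nonneg_right ha (abs_nonneg _)

lemma norm_weighted_sum_le (φ : E → V) (a : E → ℝ) {R B : ℝ} (hB : ∀ e, ‖φ e‖ ≤ B)
    (hB0 : 0 ≤ B) (ha : ∑ e, |a e| ≤ R) : ‖∑ e, a e • φ e‖ ≤ R * B := by
  refine (norm_sum_le _ _).trans ?_
  refine le_trans (Finset.sum_le_sum fun e _ => ?_)
    ((Finset.sum_mul _ _ _).symm.le.trans (mul_le_mul_of_nonneg_right ha hB0))
  rw [norm_smul, Real.norm_eq_abs]
  exact mul_le_mul_of_nonneg_left (hB e) (abs_nonneg _)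

/-- **Maurey's sparse approximation** of a point of a scaled absolutely convex hull. -/
lemma exists_sparse_approx [Nonempty E] (φ : E → V) (a : E → ℝ) {R B : ℝ}
    (hB : ∀ e, ‖φ e‖ ≤ B) (hB0 : 0 ≤ B) (ha : ∑ e, |a e| ≤ R) (N : ℕ) :
    ∃ v : Fin N → E × SignType,
      ‖(N : ℝ) • ∑ e, a e • φ e - ∑ r, (R * ((v r).2 : ℝ)) • φ (v r).1‖ ^ 2
        ≤ N * (2 * (R * B)) ^ 2 := by
  have hR : 0 ≤ R := (Finset.sum_nonneg fun _ _ => abs_nonneg _).trans ha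
  induction N with
  | zero => exact ⟨Fin.elim0, by simp⟩
  | succ N ih =>
    obtain ⟨v, hv⟩ := ih
    set z := ∑ e, a e • φ e
    set y := (N : ℝ) • z - ∑ r, (R * ((v r).2 : ℝ)) • φ (v r).1
    obtain ⟨w, hw⟩ := exists_signed_vertex_inner_ge φ a ha y
    refine ⟨Fin.snoc (α := fun _ => E × SignType) v w, ?_⟩
    have h1 : ((N + 1 : ℕ) : ℝ) • z
        - ∑ r, (R * (((Fin.snoc (α := fun _ => E × SignType) v w) r).2 : ℝ))
          • φ ((Fin.snoc (α := fun _ => E × SignType) v w) r).1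
        = y + (z - (R * (w.2 : ℝ)) • φ w.1) := by
      rw [Fin.sum_univ_castSucc]
      simp only [Fin.snoc_castSucc, Fin.snoc_last, Nat.cast_add, Nat.cast_one, add_smul, one_smul]
      simp only [y]
      abel
    have h2 : ‖z - (R * (w.2 : ℝ)) • φ w.1‖ ≤ 2 * (R * B) := by
      refine (norm_sub_le _ _).trans ?_
      linarith [norm_weighted_sum_le φ a hB hB0 ha, norm_signed_vertex_le φ hR hB w]
    -- The greedy choice of the next vertex makes the cross term nonpositive, so the squared error
    -- grows only by the squared diameter bound per step. This derandomizes Maurey's argument.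
    have h3 : inner ℝ y (z - (R * (w.2 : ℝ)) • φ w.1) ≤ 0 := by
      rw [inner_sub_right]; linarith
    rw [h1, norm_add_sq_real]
    have h4 := pow_le_pow_left₀ (norm_nonneg _) h2 2
    push_cast
    linarith

end SparseApproximation

/-! ### Parameters as combinations of single entries, and the linear gain map. -/

variable {l : ℕ} {p : ℕ → ℕ}

lemma sum_abs_eq_normOne {a b : ℕ} (A : Matrix (Fin a) (Fin b) ℝ) :
    ∑ e : Fin a × Fin b, |A e.1 e.2| = normOne A := Fintype.sum_prod_type _

lemma normOne_single {a b : ℕ} (i : Fin a) (k : Fin b) (c : ℝ) :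
    normOne (Matrix.single i k c) = |c| := by
  rw [← sum_abs_eq_normOne, Finset.sum_eq_single (i, k)]
  · simp
  · rintro ⟨i', k'⟩ - h
    rw [Matrix.single_apply_of_ne, abs_zero]
    rintro ⟨rfl, rfl⟩; exact h rfl
  · simp

/-- The positions of the entries of the inner parameters. -/
abbrev Entry (l : ℕ) (p : ℕ → ℕ) : Type := Σ j : Fin l, Fin (p (j + 1)) × Fin (p j)

/-- The inner parameters with one entry equal to `1` and all others equal to `0`. -/
def vertex (e : Entry l p) : InnerParam l p := Pi.single e.1 (Matrix.single e.2.1 e.2.2 1)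

lemma sum_smul_vertex (Δ : InnerParam l p) :
    ∑ e : Entry l p, Δ e.1 e.2.1 e.2.2 • vertex e = Δ := by
  rw [Fintype.sum_sigma]
  conv_rhs => rw [← Finset.univ_sum_single Δ]
  refine Finset.sum_congr rfl fun j _ => ?_
  conv_rhs => rw [Matrix.matrix_eq_sum_single (Δ j)]
  rw [Fintype.sum_prod_type]
  ext j' a b
  by_cases h : j' = j
  · subst h
    simp [vertex, Finset.sum_apply, Matrix.sum_apply, Matrix.single_apply]
  · simp [vertex, Finset.sum_apply, Matrix.sum_apply, h]

lemma gain_le {x : EuclideanSpace ℝ (Fin (p 0))} (Δ : InnerParam l p) (j : Fin l) :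
    gain x Δ j ≤ normOne (Δ j) * ‖WithLp.ofLp x‖ := by
  obtain ⟨j, hj⟩ := j
  rcases j with _ | j
  · rw [gain_zero]
    exact (norm_mulVec_le_normTwoOne _ _).trans
      (mul_le_mul_of_nonneg_right (normTwoOne_le_normOne _) (norm_nonneg _))
  · rw [gain_succ]
    exact mul_le_mul_of_nonneg_right
      ((frob_le_normTwoOne _).trans (normTwoOne_le_normOne _)) (norm_nonneg _)

/-- The linear map into a Euclidean space whose squared norm is the total of the squared gains. -/
noncomputable def gainVec {n : ℕ} (x : Fin n → EuclideanSpace ℝ (Fin (p 0))) :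
    InnerParam l p →ₗ[ℝ]
      EuclideanSpace ℝ ((Fin n × Σ j : Fin l, Fin (p (j + 1))) ⊕ (Fin n × Entry l p)) where
  toFun Δ := WithLp.toLp 2 (Sum.elim
    (fun s => if (s.2.1 : ℕ) = 0 then ∑ k : Fin (p s.2.1), Δ s.2.1 s.2.2 k *
      (if h : (k : ℕ) < p 0 then x s.1 ⟨k, h⟩ else 0) else 0)
    (fun s => if (s.2.1 : ℕ) = 0 then 0
      else Δ s.2.1 s.2.2.1 s.2.2.2 * ‖WithLp.ofLp (x s.1)‖))
  map_add' Δ Δ' := by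
    ext s
    rcases s with s | s
    · by_cases h : (s.2.1 : ℕ) = 0
      · simp only [h, Pi.add_apply, Matrix.add_apply, add_mul, Finset.sum_add_distrib,
          PiLp.add_apply, Sum.elim_inl, if_true]
      · simp [h]
    · by_cases h : (s.2.1 : ℕ) = 0
      · simp [h]
      · simp [h, add_mul]
  map_smul' c Δ := by
    ext s
    rcases s with s | s
    · by_cases h : (s.2.1 : ℕ) = 0
      · simp only [h, Pi.smul_apply, Matrix.smul_apply, smul_eq_mul, mul_assoc,
          ← Finset.mul_sum, PiLp.smul_apply, Sum.elim_inl, if_true, RingHom.id_apply]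
      · simp [h]
    · by_cases h : (s.2.1 : ℕ) = 0
      · simp [h]
      · simp [h, mul_assoc]

lemma norm_gainVec_sq {n : ℕ} (x : Fin n → EuclideanSpace ℝ (Fin (p 0))) (Δ : InnerParam l p) :
    ‖gainVec x Δ‖ ^ 2 = ∑ i, ∑ j, gain (x i) Δ j ^ 2 := by
  rw [EuclideanSpace.norm_sq_eq, Fintype.sum_sum_type, Fintype.sum_prod_type,
    Fintype.sum_prod_type, ← Finset.sum_add_distrib]
  refine Finset.sum_congr rfl fun i _ => ?_
  rw [Fintype.sum_sigma, Fintype.sum_sigma, ← Finset.sum_add_distrib]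
  refine Finset.sum_congr rfl fun j _ => ?_
  by_cases h : (j : ℕ) = 0
  · rw [gain, if_pos h, Real.sq_sqrt (by positivity)]
    simp [gainVec, h]
  · rw [gain, if_neg h, mul_pow, frob_sq, Fintype.sum_prod_type]
    simp [gainVec, h, mul_pow, Finset.sum_mul]

/-- A single unit entry changes only one layer, and there by at most the maximum norm of each input.
The bound is free of all widths. -/
lemma norm_gainVec_vertex_le {n : ℕ} (x : Fin n → EuclideanSpace ℝ (Fin (p 0)))
    (e : Entry l p) : ‖gainVec x (vertex e)‖ ≤ inputSize x := by
  refine Real.le_sqrt_of_sq_le ?_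
  rw [norm_gainVec_sq]
  refine Finset.sum_le_sum fun i _ => ?_
  have hg : ∀ j, gain (x i) (vertex e) j ≤ if j = e.1 then ‖WithLp.ofLp (x i)‖ else 0 := by
    intro j
    refine (gain_le _ _).trans ?_
    by_cases h : j = e.1
    · subst h
      simp [vertex, normOne_single]
    · simp [vertex, h, normOne]
  calc ∑ j, gain (x i) (vertex e) j ^ 2
      ≤ ∑ j, (if j = e.1 then ‖WithLp.ofLp (x i)‖ else 0) ^ 2 :=
        Finset.sum_le_sum fun j _ => pow_le_pow_left₀ (gain_nonneg _ _ _) (hg j) 2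
    _ = ‖WithLp.ofLp (x i)‖ ^ 2 := by simp [ite_pow]

end SparseNet

/-! ### Covering numbers from finite labellings. -/

namespace SparseNet

/-- If the points of a set are labelled such that equally labelled points satisfy `D`, then the set
has a net with at most as many points as there are labels. -/
lemma exists_net_of_labels {T κ : Type*} [Fintype κ] (M : Set T) (r : T → κ → Prop)
    (D : T → T → Prop) (hr : ∀ x ∈ M, ∃ k, r x k)
    (hD : ∀ x ∈ M, ∀ y ∈ M, ∀ k, r x k → r y k → D x y) :
    ∃ S : Finset T, ↑S ⊆ M ∧ S.card ≤ Fintype.card κ ∧ ∀ x ∈ M, ∃ y ∈ S, D x y := by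
  classical
  let K : Finset κ := Finset.univ.filter fun k => ∃ x ∈ M, r x k
  have hK : ∀ k : K, ∃ x ∈ M, r x k := fun k => (Finset.mem_filter.1 k.2).2
  choose g hgM hg using hK
  refine ⟨Finset.univ.image g, ?_, ?_, ?_⟩
  · intro x hx
    obtain ⟨k, -, rfl⟩ := Finset.mem_image.1 (Finset.mem_coe.1 hx)
    exact hgM k
  · refine Finset.card_image_le.trans ?_
    rw [Finset.card_univ, Fintype.card_coe]
    exact Finset.card_le_univ _
  · intro x hx
    obtain ⟨k, hk⟩ := hr x hx
    have hkK : k ∈ K := Finset.mem_filter.2 ⟨Finset.mem_univ _, x, hx, hk⟩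
    exact ⟨g ⟨k, hkK⟩, Finset.mem_image_of_mem _ (Finset.mem_univ _),
      hD x hx _ (hgM _) k hk (hg ⟨k, hkK⟩)⟩

variable {l : ℕ} {p : ℕ → ℕ}

lemma gainVec_eq_sum {n : ℕ} (x : Fin n → EuclideanSpace ℝ (Fin (p 0))) (Δ : InnerParam l p) :
    gainVec x Δ = ∑ e : Entry l p, Δ e.1 e.2.1 e.2.2 • gainVec x (vertex e) := by
  conv_lhs => rw [← sum_smul_vertex Δ]
  rw [map_sum]
  simp only [map_smul]

lemma sum_abs_entries (Δ : InnerParam l p) :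
    ∑ e : Entry l p, |Δ e.1 e.2.1 e.2.2| = ∑ j, normOne (Δ j) := by
  rw [Fintype.sum_sigma]
  exact Finset.sum_congr rfl fun j _ => sum_abs_eq_normOne (Δ j)

/-- This is the trade-off that removes the loss in the depth: the contraction e^{-E} beats the
ℓ₁-radius 4E + 5. Numerically, e² ≤ 8 and e^{-E}(4E + 5) ≤ 5. -/
lemma exp_two_sub_mul_le {E : ℝ} (hE : 0 ≤ E) : Real.exp (2 - E) * (4 * E + 5) ≤ 40 := by
  have h1 : Real.exp (2 - E) = Real.exp 1 * Real.exp 1 * Real.exp (-E) := by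
    rw [← Real.exp_add, ← Real.exp_add]; congr 1; ring
  have h2 : Real.exp (-E) * (4 * E + 5) ≤ 5 := by
    rw [Real.exp_neg, inv_mul_le_iff₀ (Real.exp_pos _)]
    nlinarith [Real.add_one_le_exp E]
  have h3 := Real.exp_one_lt_d9
  have h4 : Real.exp 1 * Real.exp 1 ≤ 8 := by nlinarith [Real.exp_pos 1]
  rw [h1, mul_assoc]
  have : 0 ≤ Real.exp (-E) * (4 * E + 5) := by positivity
  nlinarith [Real.exp_pos 1]

/-- A covering number bound for a class of networks whose layers are close to finite sets of
centres. The Frobenius norm of a layer controls both its distance to the centres and the Lipschitz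
constant of the layer, which avoids a loss in the depth. -/
lemma exists_net {n q : ℕ} {f : Activations l p} (hf : ∀ j, LipschitzWith 1 (f j))
    (hf0 : ∀ j, f j 0 = 0) (hl : 0 < l) (hp : ∀ j ≤ l, 0 < p j) (hq : 0 < q)
    (x : Fin n → EuclideanSpace ℝ (Fin (p 0))) {M : Set (InnerParam l p)}
    (hM : M ⊆ nodeSet l p) {C : Fin l → Type*} [∀ j, Fintype (C j)]
    (ctr : ∀ j, C j → Matrix (Fin (p (j + 1))) (Fin (p j)) ℝ)
    (hctr : ∀ Θ ∈ M, ∀ j, ∃ c, normOne (Θ j - ctr j c)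
      ≤ Real.sqrt q * (4 * (1 - frob (Θ j)) + 1 / l)) (t : ℕ) :
    ∃ S : Finset (InnerParam l p), ↑S ⊆ M ∧
      S.card ≤ (l + 1) ^ l * (∏ j, Fintype.card (C j))
        * (3 * Fintype.card (Entry l p)) ^ (25600 * 4 ^ t * l * q) ∧
      ∀ Θ ∈ M, ∃ Γ ∈ S, netDist f x Θ Γ ≤ inputSize x / 2 ^ t := by
  classical
  have hlR : (0 : ℝ) < l := Nat.cast_pos.2 hl
  have hqR : (0 : ℝ) < q := Nat.cast_pos.2 hq
  have : Nonempty (Entry l p) :=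
    ⟨⟨⟨0, hl⟩, ⟨0, hp 1 hl⟩, ⟨0, hp 0 (Nat.zero_le _)⟩⟩⟩
  -- Here 25600 = 160². Two Maurey errors sum to 4RB/sqrt N, and the factor 40 of
  -- `exp_two_sub_mul_le` turns this into exactly B/2^t.
  set N := 25600 * 4 ^ t * l * q with hN
  set B := inputSize x with hB
  have hB0 : 0 ≤ B := Real.sqrt_nonneg _
  -- The deficits 1 - ‖Θ^j‖_F are rounded down to multiples of 1/l, which loses at most 1 in total.
  -- With the 1/l per layer allowed for the centres, the radius becomes sqrt q (4(E + 1) + 1).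
  let lev : (Fin l → Fin (l + 1)) → Fin l → ℝ := fun d j => ((d j : ℕ) : ℝ) / l
  let R : (Fin l → Fin (l + 1)) → ℝ := fun d => Real.sqrt q * (4 * ∑ j, lev d j + 5)
  let κ := (Fin l → Fin (l + 1)) × (∀ j, C j) × (Fin N → Entry l p × SignType)
  let r : InnerParam l p → κ → Prop := fun Θ k =>
    (∀ j, frob (Θ j) ≤ 1 - lev k.1 j) ∧
    ‖(N : ℝ) • gainVec x (Θ - fun j => ctr j (k.2.1 j))
      - ∑ i, (R k.1 * ((k.2.2 i).2 : ℝ)) • gainVec x (vertex (k.2.2 i).1)‖ ^ 2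
      ≤ N * (2 * (R k.1 * B)) ^ 2
  have hfrob1 : ∀ Θ ∈ M, ∀ j, frob (Θ j) ≤ 1 := fun Θ hΘ j =>
    (frob_le_normTwoOne _).trans (hM hΘ j)
  have hlabel : ∀ Θ ∈ M, ∃ k, r Θ k := by
    intro Θ hΘ
    choose c hc using hctr Θ hΘ
    have hδ : ∀ j, 0 ≤ (l : ℝ) * (1 - frob (Θ j)) := fun j =>
      mul_nonneg hlR.le (sub_nonneg.2 (hfrob1 Θ hΘ j))
    have hd : ∀ j, ⌊(l : ℝ) * (1 - frob (Θ j))⌋₊ < l + 1 := fun j => by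
      refine Nat.lt_succ_of_le (Nat.floor_le_of_le ?_)
      have := frob_nonneg (Θ j)
      nlinarith
    set d : Fin l → Fin (l + 1) := fun j => ⟨_, hd j⟩ with hdd
    have hlev : ∀ j, lev d j ≤ 1 - frob (Θ j) := fun j => by
      rw [div_le_iff₀ hlR, mul_comm]
      exact Nat.floor_le (hδ j)
    have hlev' : ∀ j, 1 - frob (Θ j) ≤ lev d j + 1 / l := fun j => by
      have := (Nat.lt_floor_add_one ((l : ℝ) * (1 - frob (Θ j)))).le
      rw [← add_div, le_div_iff₀ hlR, mul_comm]
      exact this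
    have hsum1 : ∑ _j : Fin l, (1 / l : ℝ) = 1 := by
      simp [hlR.ne']
    have hR : ∑ e : Entry l p, |(Θ - fun j => ctr j (c j)) e.1 e.2.1 e.2.2| ≤ R d := by
      rw [sum_abs_entries]
      calc ∑ j, normOne ((Θ - fun j => ctr j (c j)) j)
          ≤ ∑ j, Real.sqrt q * (4 * (lev d j + 1 / l) + 1 / l) := by
            refine Finset.sum_le_sum fun j _ => (hc j).trans ?_
            refine mul_le_mul_of_nonneg_left ?_ (Real.sqrt_nonneg _)
            linarith [hlev' j]
        _ = R d := by
            rw [← Finset.mul_sum, Finset.sum_add_distrib, ← Finset.mul_sum,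
              Finset.sum_add_distrib, hsum1]
            simp only [R]; ring
    obtain ⟨v, hv⟩ := exists_sparse_approx (fun e => gainVec x (vertex e)) _
      (norm_gainVec_vertex_le x) hB0 hR N
    refine ⟨(d, c, v), fun j => by linarith [hlev j], ?_⟩
    rw [gainVec_eq_sum]
    exact hv
  have hclose : ∀ Θ ∈ M, ∀ Γ ∈ M, ∀ k, r Θ k → r Γ k → netDist f x Θ Γ ≤ B / 2 ^ t := by
    rintro Θ hΘ Γ hΓ ⟨d, c, v⟩ ⟨h1, h2⟩ ⟨h3, h4⟩
    simp only at h1 h2 h3 h4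
    set E := ∑ j, lev d j with hE
    have hlev0 : ∀ j, 0 ≤ lev d j := fun j => by positivity
    have hE0 : 0 ≤ E := Finset.sum_nonneg fun j _ => hlev0 j
    have hlev1 : ∀ j, lev d j ≤ 1 := fun j => by
      rw [div_le_one hlR]
      exact_mod_cast Nat.le_of_lt_succ (d j).2
    have hexp : ∀ y : ℝ, 1 - y ≤ Real.exp (-y) := fun y => Real.one_sub_le_exp_neg y
    have hdist := netDist_le hf hf0 (hM hΓ) (lev d) hlev1
      (fun j => (h1 j).trans (hexp _)) (fun j => (h3 j).trans (hexp _)) x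
    rw [← norm_gainVec_sq, Real.sqrt_sq (norm_nonneg _)] at hdist
    have hRd : R d = Real.sqrt q * (4 * E + 5) := rfl
    have hR0 : 0 ≤ R d := by rw [hRd]; positivity
    have hsq : Real.sqrt N = 160 * 2 ^ t * Real.sqrt l * Real.sqrt q := by
      have : (N : ℝ) = (160 * 2 ^ t) ^ 2 * l * q := by
        rw [hN, mul_pow, ← pow_mul, mul_comm t 2, pow_mul]; push_cast; norm_num
      rw [this, Real.sqrt_mul (by positivity), Real.sqrt_mul (by positivity),
        Real.sqrt_sq (by positivity)]
    have hN0 : (0 : ℝ) < N := by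
      rw [hN]; exact_mod_cast (by positivity)
    have hNs : 0 < Real.sqrt N := Real.sqrt_pos.2 hN0
    have hroot : ∀ z : EuclideanSpace ℝ ((Fin n × Σ j : Fin l, Fin (p (j + 1))) ⊕
        (Fin n × Entry l p)), ‖z‖ ^ 2 ≤ N * (2 * (R d * B)) ^ 2 →
        ‖z‖ ≤ Real.sqrt N * (2 * (R d * B)) := fun z hz => by
      refine le_of_sq_le_sq ?_ (by positivity)
      rwa [mul_pow, Real.sq_sqrt hN0.le]
    -- Equal labels mean equal centres and equal sparse sums, so both cancel in the difference of
    -- the two parameters.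
    have h5 := (norm_sub_le _ _).trans (add_le_add (hroot _ h2) (hroot _ h4))
    rw [sub_sub_sub_cancel_right, ← smul_sub, ← map_sub, sub_sub_sub_cancel_right, norm_smul,
      Real.norm_of_nonneg hN0.le] at h5
    have h6 : Real.sqrt N * ‖gainVec x (Θ - Γ)‖ ≤ 4 * (R d * B) := by
      have : Real.sqrt N * (Real.sqrt N * ‖gainVec x (Θ - Γ)‖) ≤ Real.sqrt N * (4 * (R d * B)) := by
        rw [← mul_assoc, Real.mul_self_sqrt hN0.le]; linarith
      exact le_of_mul_le_mul_left this hNs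
    rw [hsq, hRd] at h6
    have hsl : 0 < Real.sqrt l := Real.sqrt_pos.2 hlR
    have hsq' : 0 < Real.sqrt q := Real.sqrt_pos.2 hqR
    have h7 : Real.sqrt l * ‖gainVec x (Θ - Γ)‖ * (40 * 2 ^ t) ≤ (4 * E + 5) * B := by
      refine le_of_mul_le_mul_left ?_ (mul_pos (by norm_num : (0 : ℝ) < 4) hsq')
      linarith
    refine hdist.trans ?_
    rw [le_div_iff₀ (by positivity)]
    have h8 := mul_le_mul_of_nonneg_left h7 (Real.exp_pos (2 - E)).le
    have h9 := mul_le_mul_of_nonneg_right (exp_two_sub_mul_le hE0) hB0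
    linarith
  obtain ⟨S, hSM, hScard, hS⟩ := exists_net_of_labels (κ := κ) M r
    (fun Θ Γ => netDist f x Θ Γ ≤ B / 2 ^ t) hlabel hclose
  refine ⟨S, hSM, hScard.trans_eq ?_, hS⟩
  have h3 : Fintype.card SignType = 3 := rfl
  simp only [κ, Fintype.card_prod, Fintype.card_pi, Fintype.card_fin, Finset.prod_const,
      Finset.card_univ, h3]
  ring

end SparseNet

/-! ### Finite sets of centres for the two sparsity classes. -/

namespace SparseNet

/-- If μ is the largest absolute entry, then ‖A‖_F² ≤ μ‖A‖₁ ≤ μ. Moving that entry to ±1 and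
dropping the rest costs at most 2(1 - μ) ≤ 2(1 - ‖A‖_F²) ≤ 4(1 - ‖A‖_F). -/
lemma exists_signed_single_near {a b : ℕ} (ha : 0 < a) (hb : 0 < b)
    (A : Matrix (Fin a) (Fin b) ℝ) (hA : normOne A ≤ 1) :
    ∃ c : (Fin a × Fin b) × SignType,
      normOne (A - Matrix.single c.1.1 c.1.2 (c.2 : ℝ)) ≤ 4 * (1 - frob A) := by
  classical
  have : Nonempty (Fin a × Fin b) := ⟨(⟨0, ha⟩, ⟨0, hb⟩)⟩
  obtain ⟨e₀, -, h₀⟩ := Finset.exists_max_image Finset.univ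
    (fun e : Fin a × Fin b => |A e.1 e.2|) Finset.univ_nonempty
  set μ := |A e₀.1 e₀.2| with hμ
  have hsum : ∑ e : Fin a × Fin b, |A e.1 e.2| ≤ 1 := (sum_abs_eq_normOne A).trans_le hA
  have hF : frob A ^ 2 ≤ μ := by
    rw [frob_sq, ← Fintype.sum_prod_type' (fun i k => A i k ^ 2)]
    calc ∑ e : Fin a × Fin b, A e.1 e.2 ^ 2 ≤ ∑ e : Fin a × Fin b, μ * |A e.1 e.2| := by
          refine Finset.sum_le_sum fun e _ => ?_
          rw [← sq_abs, sq]
          exact mul_le_mul_of_nonneg_right (h₀ e (Finset.mem_univ _)) (abs_nonneg _)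
      _ ≤ μ := by
          rw [← Finset.mul_sum]
          exact mul_le_of_le_one_right (abs_nonneg _) hsum
  rw [← Finset.add_sum_erase _ _ (Finset.mem_univ e₀)] at hsum
  have hrest : 0 ≤ ∑ e ∈ Finset.univ.erase e₀, |A e.1 e.2| :=
    Finset.sum_nonneg fun _ _ => abs_nonneg _
  refine ⟨(e₀, SignType.sign (A e₀.1 e₀.2)), ?_⟩
  rw [← sum_abs_eq_normOne, ← Finset.add_sum_erase _ _ (Finset.mem_univ e₀)]
  have h1 : |(A - Matrix.single e₀.1 e₀.2 ((SignType.sign (A e₀.1 e₀.2) : SignType) : ℝ))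
      e₀.1 e₀.2| ≤ 1 - μ := by
    have hμ1 : μ ≤ 1 := by linarith
    simp only [Matrix.sub_apply, Matrix.single_apply_same]
    rcases lt_trichotomy (A e₀.1 e₀.2) 0 with h | h | h
    · rw [hμ, abs_of_neg h] at hμ1 ⊢
      rw [sign_neg h]; simp only [SignType.coe_neg_one]
      rw [abs_of_nonneg (by linarith)]; linarith
    · rw [hμ, h]; simp
    · rw [hμ, abs_of_pos h] at hμ1 ⊢
      rw [sign_pos h]; simp only [SignType.coe_one]
      rw [abs_of_nonpos (by linarith)]; linarith
  have h2 : ∑ e ∈ Finset.univ.erase e₀,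
      |(A - Matrix.single e₀.1 e₀.2 ((SignType.sign (A e₀.1 e₀.2) : SignType) : ℝ)) e.1 e.2|
      = ∑ e ∈ Finset.univ.erase e₀, |A e.1 e.2| := by
    refine Finset.sum_congr rfl fun e he => ?_
    rw [Matrix.sub_apply, Matrix.single_apply_of_ne, sub_zero]
    rintro ⟨h, h'⟩
    exact (Finset.mem_erase.1 he).1 (Prod.ext h.symm h'.symm)
  rw [h2]
  nlinarith [sq_nonneg (frob A - 1)]

/-- The matrix with the column `k` on the grid `{-1, …, 1}` of mesh `1 / G` and all other columns
equal to zero. -/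
noncomputable def gridColumn {a b : ℕ} (G : ℕ) (c : Fin b × (Fin a → Fin (2 * G + 1))) :
    Matrix (Fin a) (Fin b) ℝ :=
  Matrix.of fun i k => if k = c.1 then (((c.2 i : ℕ) : ℝ) - G) / G else 0

lemma exists_grid_near {G : ℕ} (hG : 0 < G) {y : ℝ} (hy : |y| ≤ 1) :
    ∃ g : Fin (2 * G + 1), |y - (((g : ℕ) : ℝ) - G) / G| ≤ 1 / G := by
  have hGR : (0 : ℝ) < G := Nat.cast_pos.2 hG
  obtain ⟨h1, h2⟩ := abs_le.1 hy
  have h0 : 0 ≤ (y + 1) * G := by nlinarith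
  have hlt : ⌊(y + 1) * G⌋₊ < 2 * G + 1 := by
    refine Nat.lt_succ_of_le (Nat.floor_le_of_le ?_)
    push_cast; nlinarith
  refine ⟨⟨_, hlt⟩, ?_⟩
  have h3 := Nat.floor_le h0
  have h4 := Nat.lt_floor_add_one ((y + 1) * (G : ℝ))
  have : y - ((⌊(y + 1) * G⌋₊ : ℝ) - G) / G = ((y + 1) * G - ⌊(y + 1) * G⌋₊) / G := by
    field_simp; ring
  simp only
  rw [this, abs_of_nonneg (div_nonneg (by linarith) hGR.le)]
  gcongr
  linarith

/-- The dominant column is kept and rounded to mesh 1/(la), an ℓ₁-error of 1/l. The other columns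
have total norm at most 1 - ‖A‖_F², and passing from their Euclidean to their ℓ₁-norms costs sqrt a.
-/
lemma exists_gridColumn_near {a b l : ℕ} (ha : 0 < a) (hb : 0 < b) (hl : 0 < l)
    (A : Matrix (Fin a) (Fin b) ℝ) (hA : normTwoOne A ≤ 1) :
    ∃ c : Fin b × (Fin a → Fin (2 * (l * a) + 1)),
      normOne (A - gridColumn (l * a) c) ≤ Real.sqrt a * (4 * (1 - frob A) + 1 / l) := by
  classical
  have : Nonempty (Fin b) := ⟨⟨0, hb⟩⟩
  have haR : (0 : ℝ) < a := Nat.cast_pos.2 ha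
  have hlR : (0 : ℝ) < l := Nat.cast_pos.2 hl
  obtain ⟨k₀, -, h₀⟩ := Finset.exists_max_image Finset.univ (colNorm A) Finset.univ_nonempty
  set μ := colNorm A k₀ with hμ
  rw [normTwoOne_eq] at hA
  have hF : frob A ^ 2 ≤ μ := by
    rw [frob_sq_eq_sum_colNorm]
    calc ∑ k, colNorm A k ^ 2 ≤ ∑ k, μ * colNorm A k := by
          refine Finset.sum_le_sum fun k _ => ?_
          rw [sq]
          exact mul_le_mul_of_nonneg_right (h₀ k (Finset.mem_univ _)) (colNorm_nonneg A k)
      _ ≤ μ := by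
          rw [← Finset.mul_sum]
          exact mul_le_of_le_one_right (colNorm_nonneg A k₀) hA
  rw [← Finset.add_sum_erase _ _ (Finset.mem_univ k₀)] at hA
  have hrest : 0 ≤ ∑ k ∈ Finset.univ.erase k₀, colNorm A k :=
    Finset.sum_nonneg fun k _ => colNorm_nonneg A k
  have hentry : ∀ i, |A i k₀| ≤ 1 := fun i => by
    have h1 : A i k₀ ^ 2 ≤ μ ^ 2 := by
      rw [hμ, colNorm_sq]
      exact Finset.single_le_sum (f := fun i => A i k₀ ^ 2) (fun _ _ => sq_nonneg _)
        (Finset.mem_univ i)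
    have h2 := abs_le_of_sq_le_sq h1 (colNorm_nonneg A k₀)
    exact h2.trans (by linarith)
  choose g hg using fun i => exists_grid_near (Nat.mul_pos hl ha) (hentry i)
  refine ⟨(k₀, g), ?_⟩
  rw [normOne, Finset.sum_comm, ← Finset.add_sum_erase _ _ (Finset.mem_univ k₀)]
  have h1 : ∑ i, |(A - gridColumn (l * a) (k₀, g)) i k₀| ≤ 1 / l := by
    calc ∑ i, |(A - gridColumn (l * a) (k₀, g)) i k₀| ≤ ∑ _i : Fin a, 1 / ((l * a : ℕ) : ℝ) := by
          refine Finset.sum_le_sum fun i _ => ?_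
          simpa [gridColumn] using hg i
      _ = 1 / l := by
          rw [Finset.sum_const, Finset.card_univ, Fintype.card_fin, nsmul_eq_mul]
          push_cast; field_simp
  have h2 : ∑ k ∈ Finset.univ.erase k₀, ∑ i, |(A - gridColumn (l * a) (k₀, g)) i k|
      ≤ Real.sqrt a * ∑ k ∈ Finset.univ.erase k₀, colNorm A k := by
    rw [Finset.mul_sum]
    refine Finset.sum_le_sum fun k hk => ?_
    have : k ≠ k₀ := (Finset.mem_erase.1 hk).1
    refine le_trans (le_of_eq ?_) (sum_abs_le_sqrt_mul_colNorm A k)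
    simp [gridColumn, this]
  have hsa : 1 ≤ Real.sqrt a := Real.one_le_sqrt.2 (Nat.one_le_cast.2 ha)
  have h3 : 1 / (l : ℝ) ≤ Real.sqrt a * (1 / l) := le_mul_of_one_le_left (by positivity) hsa
  have h4 : ∑ k ∈ Finset.univ.erase k₀, colNorm A k ≤ 4 * (1 - frob A) := by
    have hF1 : frob A ≤ 1 := by nlinarith [frob_nonneg A]
    nlinarith [sq_nonneg (frob A - 1)]
  have h5 := mul_le_mul_of_nonneg_left h4 (Real.sqrt_nonneg (a : ℝ))
  rw [mul_add]
  linarith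

/-! ### Counting labels by powers of one number `Q`. -/

section Counting

variable {l : ℕ} {p : ℕ → ℕ}

lemma mul_le_numParams {j : ℕ} (hj : j ≤ l) : p (j + 1) * p j ≤ numParams l p :=
  Finset.single_le_sum (f := fun j => p (j + 1) * p j) (fun _ _ => Nat.zero_le _)
    (Finset.mem_range.2 (Nat.lt_succ_of_le hj))

lemma card_entry_le : Fintype.card (Entry l p) ≤ numParams l p := by
  rw [Fintype.card_sigma, numParams, Finset.sum_range_succ, ← Fin.sum_univ_eq_sum_range
    (fun j => p (j + 1) * p j)]
  simp

lemma succ_le_numParams (hp : ∀ j ≤ l + 1, 0 < p j) : l + 1 ≤ numParams l p := by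
  have : ∑ _j ∈ Finset.range (l + 1), 1 ≤ numParams l p := by
    refine Finset.sum_le_sum fun j hj => ?_
    have := Finset.mem_range.1 hj
    exact Nat.mul_pos (hp _ (by omega)) (hp _ (by omega))
  simpa using this

lemma card_con_centres_le (j : Fin l) {Q : ℕ} (hQ : 4 * numParams l p ≤ Q) :
    Fintype.card ((Fin (p (j + 1)) × Fin (p j)) × SignType) ≤ Q ^ 3 := by
  have h3 : Fintype.card SignType = 3 := rfl
  have := mul_le_numParams (p := p) j.2.le
  simp only [Fintype.card_prod, Fintype.card_fin, h3]
  exact le_trans (by omega) (Nat.le_self_pow (by norm_num) Q)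

lemma card_node_centres_le (hp : ∀ j ≤ l + 1, 0 < p j) (j : Fin l) {q Q : ℕ}
    (hQ : 4 * numParams l p ≤ Q) (hq : p (j + 1) ≤ q) :
    Fintype.card (Fin (p j) × (Fin (p (j + 1)) → Fin (2 * (l * p (j + 1)) + 1)))
      ≤ Q ^ (3 * q) := by
  have hpos : 0 < p (j + 1) := hp _ (by omega)
  have hpos' : 0 < p j := hp _ (by omega)
  have h1 := mul_le_numParams (p := p) j.2.le
  have h2 := succ_le_numParams hp
  have h3 : p j ≤ Q := by nlinarith
  have h4 : p (j + 1) ≤ numParams l p := by nlinarith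
  have h5 : 2 * (l * p (j + 1)) + 1 ≤ Q ^ 2 := by
    have : l * p (j + 1) ≤ numParams l p * numParams l p := Nat.mul_le_mul (by omega) h4
    have : (4 * numParams l p) * (4 * numParams l p) ≤ Q * Q := Nat.mul_le_mul hQ hQ
    nlinarith
  have hQ1 : 1 ≤ Q := by omega
  simp only [Fintype.card_prod, Fintype.card_fin, Fintype.card_pi, Finset.prod_const,
    Finset.card_univ]
  calc p j * (2 * (l * p (j + 1)) + 1) ^ p (j + 1) ≤ Q * (Q ^ 2) ^ q :=
        Nat.mul_le_mul h3 ((Nat.pow_le_pow_left h5 _).trans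
          (Nat.pow_le_pow_right (Nat.pow_pos hQ1) hq))
    _ = Q ^ (1 + 2 * q) := by rw [← pow_mul, pow_add, pow_one]
    _ ≤ Q ^ (3 * q) := Nat.pow_le_pow_right hQ1 (by omega)

/-- The exponent is 25604 = 25600 + 3 + 1: Maurey vertices, centres and rounded deficits. The 3 in
the base counts the values of `SignType`. -/
lemma card_labels_le (hp : ∀ j ≤ l + 1, 0 < p j) {q Q : ℕ} (hq : 0 < q)
    (hQ : 4 * numParams l p ≤ Q) (c : Fin l → ℕ) (hc : ∀ j, c j ≤ Q ^ (3 * q)) (t : ℕ) :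
    (l + 1) ^ l * (∏ j, c j) * (3 * Fintype.card (Entry l p)) ^ (25600 * 4 ^ t * l * q)
      ≤ Q ^ (25604 * 4 ^ t * l * q) := by
  have h2 := succ_le_numParams hp
  have hQ1 : 1 ≤ Q := by omega
  have h1 : (l + 1) ^ l ≤ Q ^ l := Nat.pow_le_pow_left (by omega) _
  have h3 : ∏ j, c j ≤ Q ^ (3 * q * l) := by
    refine (Finset.prod_le_prod' fun j _ => hc j).trans_eq ?_
    rw [Finset.prod_const, Finset.card_univ, Fintype.card_fin, ← pow_mul]
  have h4 : 3 * Fintype.card (Entry l p) ≤ Q := by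
    have := card_entry_le (l := l) (p := p); omega
  calc _ ≤ Q ^ l * Q ^ (3 * q * l) * Q ^ (25600 * 4 ^ t * l * q) :=
        Nat.mul_le_mul (Nat.mul_le_mul h1 h3) (Nat.pow_le_pow_left h4 _)
    _ = Q ^ (l + 3 * q * l + 25600 * 4 ^ t * l * q) := by rw [pow_add, pow_add]
    _ ≤ Q ^ (25604 * 4 ^ t * l * q) := by
        refine Nat.pow_le_pow_right hQ1 ?_
        have h5 : l ≤ l * q := Nat.le_mul_of_pos_right l hq
        have h6 : 1 * (l * q) ≤ 4 ^ t * (l * q) := Nat.mul_le_mul_right _ (Nat.one_le_pow t 4 (by norm_num))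
        have h7 : 3 * q * l = 3 * (l * q) := by ring
        have h8 : 25600 * 4 ^ t * l * q = 25600 * (4 ^ t * (l * q)) := by ring
        have h9 : 25604 * 4 ^ t * l * q = 25604 * (4 ^ t * (l * q)) := by ring
        omega

end Counting

/-- The covering number bound for connection-sparse networks. -/
lemma exists_net_conSet {n l Q : ℕ} {p : ℕ → ℕ} {f : Activations l p}
    (hf : ∀ j, LipschitzWith 1 (f j)) (hf0 : ∀ j, f j 0 = 0) (hl : 0 < l)
    (hp : ∀ j ≤ l + 1, 0 < p j) (hQ : 4 * numParams l p ≤ Q)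
    (x : Fin n → EuclideanSpace ℝ (Fin (p 0))) (t : ℕ) :
    ∃ S : Finset (InnerParam l p), ↑S ⊆ nodeSet l p ∧ S.card ≤ Q ^ (25604 * 4 ^ t * l * 1) ∧
      ∀ Θ ∈ conSet l p, ∃ Γ ∈ S, netDist f x Θ Γ ≤ inputSize x / 2 ^ t := by
  have hM := conSet_subset_nodeSet l p
  obtain ⟨S, hSM, hS, hS'⟩ := exists_net (q := 1) hf hf0 hl (fun j hj => hp j (by omega)) one_pos x
    hM (C := fun j => (Fin (p (j + 1)) × Fin (p j)) × SignType)
    (fun j c => Matrix.single c.1.1 c.1.2 (c.2 : ℝ)) (fun Θ hΘ j => by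
      obtain ⟨c, hc⟩ := exists_signed_single_near (hp (j + 1) (by omega)) (hp j (by omega))
        (Θ j) (hΘ j)
      refine ⟨c, hc.trans ?_⟩
      simp) t
  exact ⟨S, hSM.trans hM, hS.trans (card_labels_le hp one_pos hQ _
    (fun j => card_con_centres_le j hQ) t), hS'⟩

lemma le_maxWidth {l : ℕ} {p : ℕ → ℕ} (j : Fin l) : p (j + 1) ≤ maxWidth l p :=
  Finset.le_sup (f := p) (Finset.mem_Icc.2 ⟨by omega, j.2⟩)

lemma maxWidth_pos {l : ℕ} {p : ℕ → ℕ} (hl : 0 < l) (hp : ∀ j ≤ l + 1, 0 < p j) :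
    0 < maxWidth l p := (hp 1 (by omega)).trans_le (le_maxWidth ⟨0, hl⟩)

/-- The covering number bound for node-sparse networks. -/
lemma exists_net_nodeSet {n l Q : ℕ} {p : ℕ → ℕ} {f : Activations l p}
    (hf : ∀ j, LipschitzWith 1 (f j)) (hf0 : ∀ j, f j 0 = 0) (hl : 0 < l)
    (hp : ∀ j ≤ l + 1, 0 < p j) (hQ : 4 * numParams l p ≤ Q)
    (x : Fin n → EuclideanSpace ℝ (Fin (p 0))) (t : ℕ) :
    ∃ S : Finset (InnerParam l p), ↑S ⊆ nodeSet l p ∧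
      S.card ≤ Q ^ (25604 * 4 ^ t * l * maxWidth l p) ∧
      ∀ Θ ∈ nodeSet l p, ∃ Γ ∈ S, netDist f x Θ Γ ≤ inputSize x / 2 ^ t := by
  have hq := maxWidth_pos hl hp
  obtain ⟨S, hSM, hS, hS'⟩ := exists_net hf hf0 hl (fun j hj => hp j (by omega)) hq x
    subset_rfl (C := fun j => Fin (p j) × (Fin (p (j + 1)) → Fin (2 * (l * p (j + 1)) + 1)))
    (fun j c => gridColumn (l * p (j + 1)) c) (fun Θ hΘ j => by
      obtain ⟨c, hc⟩ := exists_gridColumn_near (hp (j + 1) (by omega)) (hp j (by omega)) hl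
        (Θ j) (hΘ j)
      refine ⟨c, hc.trans (mul_le_mul_of_nonneg_right
        (Real.sqrt_le_sqrt (Nat.cast_le.2 (le_maxWidth j))) ?_)⟩
      have := (frob_le_normTwoOne (Θ j)).trans (hΘ j)
      have h' : (0 : ℝ) ≤ 1 / l := by positivity
      linarith) t
  exact ⟨S, hSM, hS.trans (card_labels_le hp hq hQ _
    (fun j => card_node_centres_le hp j hQ (le_maxWidth j)) t), hS'⟩

end SparseNet

/-! ### Moment generating functions and tails of subgaussian variables. -/

namespace SparseNet

/-- The linear term is kept apart so that it vanishes on integrating a centred variable. -/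
lemma exp_le_add_exp_sq (y : ℝ) : Real.exp y ≤ y + Real.exp (y ^ 2) := by
  have h1 := Real.add_one_le_exp (y ^ 2)
  rcases le_or_gt |y| 1 with h | h
  · have h2 := (abs_le.1 (Real.abs_exp_sub_one_sub_id_le h)).2
    linarith
  · rcases lt_abs.1 h with h | h
    · have : Real.exp y ≤ Real.exp (y ^ 2) := Real.exp_le_exp.2 (by nlinarith)
      linarith
    · have : Real.exp y ≤ 1 := Real.exp_le_one_iff.2 (by linarith)
      nlinarith

section Subgaussian

variable {Ω : Type*} [MeasurableSpace Ω] {P : Measure Ω}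

lemma exp_mul_le_exp_sq {K : ℝ} (hK : 0 < K) (t y : ℝ) :
    Real.exp (t * y) ≤ Real.exp (t ^ 2 * K ^ 2 / 4) * Real.exp (y ^ 2 / K ^ 2) := by
  rw [← Real.exp_add, Real.exp_le_exp]
  have : t ^ 2 * K ^ 2 / 4 + y ^ 2 / K ^ 2 - t * y = (t * K / 2 - y / K) ^ 2 := by
    field_simp; ring
  nlinarith [sq_nonneg (t * K / 2 - y / K)]

lemma integrable_exp_mul_of_exp_sq {K : ℝ} (hK : 0 < K) {X : Ω → ℝ} (hX : AEMeasurable X P)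
    (hint : Integrable (fun ω => Real.exp (X ω ^ 2 / K ^ 2)) P) (t : ℝ) :
    Integrable (fun ω => Real.exp (t * X ω)) P := by
  refine (hint.const_mul (Real.exp (t ^ 2 * K ^ 2 / 4))).mono'
    (Real.measurable_exp.comp_aemeasurable (hX.const_mul t)).aestronglyMeasurable ?_
  refine Filter.Eventually.of_forall fun ω => ?_
  rw [Real.norm_of_nonneg (Real.exp_pos _).le]
  exact exp_mul_le_exp_sq hK t (X ω)

lemma integrable_of_exp_sq {K : ℝ} (hK : 0 < K) {X : Ω → ℝ} (hX : AEMeasurable X P)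
    (hint : Integrable (fun ω => Real.exp (X ω ^ 2 / K ^ 2)) P) : Integrable X P := by
  refine (hint.const_mul K).mono' hX.aestronglyMeasurable (Filter.Eventually.of_forall fun ω => ?_)
  rw [Real.norm_eq_abs, ← div_le_iff₀' hK]
  have h1 := Real.add_one_le_exp (X ω ^ 2 / K ^ 2)
  have h2 : X ω ^ 2 / K ^ 2 = (|X ω| / K) ^ 2 := by rw [div_pow, sq_abs]
  rw [h2] at h1 ⊢
  nlinarith [sq_nonneg (|X ω| / K - 1)]

/-- A centred random variable with a finite `ψ₂`-moment has a subgaussian moment generating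
function. -/
lemma hasSubgaussianMGF_of_exp_sq [IsProbabilityMeasure P] {K σ : ℝ} (hK : 0 < K) {X : Ω → ℝ}
    (hX : AEMeasurable X P) (hint : Integrable (fun ω => Real.exp (X ω ^ 2 / K ^ 2)) P)
    (hmean : ∫ ω, X ω ∂P = 0)
    (hσ : K ^ 2 * ((∫ ω, Real.exp (X ω ^ 2 / K ^ 2) ∂P) - 1) ≤ σ ^ 2) :
    HasSubgaussianMGF X (Real.toNNReal (K ^ 2 / 2 + 2 * σ ^ 2)) P where
  integrable_exp_mul := integrable_exp_mul_of_exp_sq hK hX hint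
  mgf_le t := by
    rw [Real.coe_toNNReal _ (by positivity), mgf]
    set C := ∫ ω, Real.exp (X ω ^ 2 / K ^ 2) ∂P
    have hexp := integrable_exp_mul_of_exp_sq hK hX hint t
    have hK2 : 0 < K ^ 2 := by positivity
    -- For small t, centring removes the linear term and convexity of exp compares e^{t²X²} with
    -- e^{X²/K²}. For large t, Young's inequality suffices, and 1/K² < t² turns the moment bound
    -- into e^{t²σ²}.
    rcases le_or_gt (t ^ 2 * K ^ 2) 1 with hs | hs
    · have hpt : ∀ ω, Real.exp (t * X ω)
          ≤ t * X ω + ((1 - t ^ 2 * K ^ 2) + t ^ 2 * K ^ 2 * Real.exp (X ω ^ 2 / K ^ 2)) := by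
        intro ω
        refine (exp_le_add_exp_sq _).trans (by
          gcongr
          have := convexOn_exp.2 (Set.mem_univ (0 : ℝ)) (Set.mem_univ (X ω ^ 2 / K ^ 2))
            (sub_nonneg.2 hs) (by positivity : 0 ≤ t ^ 2 * K ^ 2) (by ring)
          simp only [smul_eq_mul, mul_zero, zero_add, Real.exp_zero, mul_one] at this
          refine le_trans (le_of_eq ?_) this
          congr 1; field_simp)
      have hXi := integrable_of_exp_sq hK hX hint
      have hr : Integrable (fun ω => (1 - t ^ 2 * K ^ 2)
          + t ^ 2 * K ^ 2 * Real.exp (X ω ^ 2 / K ^ 2)) P :=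
        (integrable_const _).add (hint.const_mul _)
      have h1 := integral_mono hexp ((hXi.const_mul t).add hr) hpt
      have h2 : ∫ ω, (t * X ω + ((1 - t ^ 2 * K ^ 2)
          + t ^ 2 * K ^ 2 * Real.exp (X ω ^ 2 / K ^ 2))) ∂P
          = 1 + t ^ 2 * (K ^ 2 * (C - 1)) := by
        rw [integral_add (hXi.const_mul t) hr, integral_add (integrable_const _)
          (hint.const_mul _), integral_const_mul, integral_const_mul, hmean]
        simp only [integral_const, probReal_univ, smul_eq_mul, C]; ring
      have h3 := Real.add_one_le_exp ((K ^ 2 / 2 + 2 * σ ^ 2) * t ^ 2 / 2)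
      have h4 := mul_le_mul_of_nonneg_left hσ (sq_nonneg t)
      refine (h1.trans_eq h2).trans ?_
      nlinarith [mul_nonneg hK2.le (sq_nonneg t)]
    · have h1 := integral_mono hexp (hint.const_mul (Real.exp (t ^ 2 * K ^ 2 / 4)))
        fun ω => exp_mul_le_exp_sq hK t (X ω)
      rw [integral_const_mul] at h1
      refine h1.trans ?_
      have hC1 : 1 ≤ C := by
        have := integral_mono (integrable_const (1 : ℝ)) hint fun ω =>
          (Real.one_le_exp (by positivity : 0 ≤ X ω ^ 2 / K ^ 2))
        simpa using this
      have h2 : C ≤ Real.exp (t ^ 2 * σ ^ 2) := by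
        have := Real.add_one_le_exp (t ^ 2 * σ ^ 2)
        have h3 := mul_le_mul_of_nonneg_left hσ (sq_nonneg t)
        nlinarith
      refine (mul_le_mul_of_nonneg_left h2 (Real.exp_pos _).le).trans_eq ?_
      rw [← Real.exp_add]; congr 1; ring

variable {ι : Type*} [Fintype ι]

/-- A two-sided tail bound for weighted sums of independent subgaussian random variables. -/
lemma measureReal_lt_abs_sum_le [IsProbabilityMeasure P] {X : ι → Ω → ℝ} (hind : iIndepFun X P)
    {τ : NNReal} (hX : ∀ i, HasSubgaussianMGF (X i) τ P) (hτ : 0 < τ) (w : ι → ℝ) {y : ℝ} (hy : 0 ≤ y) :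
    P.real {ω | Real.sqrt (2 * τ * y) * Real.sqrt (∑ i, w i ^ 2) < |∑ i, X i ω * w i|}
      ≤ 2 * Real.exp (-y) := by
  have hw0 : 0 ≤ ∑ i, w i ^ 2 := Finset.sum_nonneg fun _ _ => sq_nonneg _
  -- Vanishing weights are split off because the Chernoff exponent divides by the sum of their
  -- squares.
  rcases hw0.eq_or_lt with hw | hw
  · have h0 : ∀ i, w i = 0 := fun i => by
      have := (Finset.sum_eq_zero_iff_of_nonneg fun i _ => sq_nonneg (w i)).1 hw.symm i
        (Finset.mem_univ i)
      exact pow_eq_zero_iff two_ne_zero |>.1 this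
    simp [h0, (Real.exp_pos (-y)).le]
  have hτR : (0 : ℝ) < τ := hτ
  have hsub : HasSubgaussianMGF (fun ω => ∑ i, X i ω * w i)
      (∑ i, ⟨w i ^ 2, sq_nonneg (w i)⟩ * τ) P := by
    have hind' : iIndepFun (fun i ω => w i * X i ω) P :=
      hind.comp (fun i z => w i * z) fun i => measurable_const_mul (w i)
    have := HasSubgaussianMGF.sum_of_iIndepFun hind' (s := Finset.univ)
      (fun i _ => (hX i).const_mul (w i))
    simpa only [mul_comm] using this
  have hc : ((∑ i, ⟨w i ^ 2, sq_nonneg (w i)⟩ * τ : NNReal) : ℝ) = (∑ i, w i ^ 2) * τ := by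
    push_cast
    rw [Finset.sum_mul]
    rfl
  set s := Real.sqrt (2 * τ * y) * Real.sqrt (∑ i, w i ^ 2) with hs
  have hs0 : 0 ≤ s := by positivity
  have hs2 : -s ^ 2 / (2 * ((∑ i, w i ^ 2) * τ)) = -y := by
    rw [hs, mul_pow, Real.sq_sqrt (by positivity), Real.sq_sqrt hw0]
    field_simp
  have h1 := hsub.measure_ge_le hs0
  have h2 := hsub.neg.measure_ge_le hs0
  rw [hc, hs2] at h1 h2
  have hsubset : {ω | s < |∑ i, X i ω * w i|}
      ⊆ {ω | s ≤ ∑ i, X i ω * w i} ∪ {ω | s ≤ (-fun ω => ∑ i, X i ω * w i) ω} := by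
    intro ω (hω : s < |∑ i, X i ω * w i|)
    rcases lt_abs.1 hω with h | h
    · exact Or.inl h.le
    · exact Or.inr h.le
  refine (measureReal_mono hsubset).trans ((measureReal_union_le _ _).trans ?_)
  linarith

/-- Markov's inequality for e^{X²/K²}, whose mean is at most e^{σ²/K²}; the shift in the threshold
absorbs that mean. -/
lemma measureReal_lt_abs_le [IsProbabilityMeasure P] {K σ : ℝ} (hK : 0 < K) {X : Ω → ℝ}
    (hint : Integrable (fun ω => Real.exp (X ω ^ 2 / K ^ 2)) P)
    (hσ : K ^ 2 * ((∫ ω, Real.exp (X ω ^ 2 / K ^ 2) ∂P) - 1) ≤ σ ^ 2) (y : ℝ) (hy : 0 ≤ y) :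
    P.real {ω | K * Real.sqrt (y + σ ^ 2 / K ^ 2) < |X ω|} ≤ Real.exp (-y) := by
  have hK2 : 0 < K ^ 2 := by positivity
  set z := y + σ ^ 2 / K ^ 2 with hz
  have hz0 : 0 ≤ z := by positivity
  have hsub : {ω | K * Real.sqrt z < |X ω|} ⊆ {ω | Real.exp z ≤ Real.exp (X ω ^ 2 / K ^ 2)} := by
    intro ω (hω : K * Real.sqrt z < |X ω|)
    have h1 := pow_le_pow_left₀ (by positivity) hω.le 2
    rw [mul_pow, Real.sq_sqrt hz0, sq_abs] at h1
    refine Real.exp_le_exp.2 ?_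
    rw [le_div_iff₀ hK2]; linarith
  have h1 := mul_meas_ge_le_integral_of_nonneg
    (Filter.Eventually.of_forall fun ω => (Real.exp_pos (X ω ^ 2 / K ^ 2)).le) hint (Real.exp z)
  have h2 : ∫ ω, Real.exp (X ω ^ 2 / K ^ 2) ∂P ≤ Real.exp (σ ^ 2 / K ^ 2) := by
    have h3 := Real.add_one_le_exp (σ ^ 2 / K ^ 2)
    have h4 : (∫ ω, Real.exp (X ω ^ 2 / K ^ 2) ∂P) - 1 ≤ σ ^ 2 / K ^ 2 := by
      rw [le_div_iff₀ hK2]; linarith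
    linarith
  refine (measureReal_mono hsub).trans ?_
  have h3 := h1.trans h2
  have h4 : Real.exp (σ ^ 2 / K ^ 2) = Real.exp z * Real.exp (-y) := by
    rw [← Real.exp_add, hz]; congr 1; ring
  rw [h4] at h3
  exact le_of_mul_le_mul_left h3 (Real.exp_pos z)

end Subgaussian

end SparseNet

/-! ### Chaining over the nets and the union bound. -/

namespace SparseNet

section Chaining

variable {l n : ℕ} {p : ℕ → ℕ} {f : Activations l p} {x : Fin n → EuclideanSpace ℝ (Fin (p 0))}

lemma sqrt_sum_coord_le_netDist (Θ Γ : InnerParam l p) (b : Fin (p l)) :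
    Real.sqrt (∑ i, (innerNet f Θ (x i) b - innerNet f Γ (x i) b) ^ 2) ≤ netDist f x Θ Γ := by
  refine Real.sqrt_le_sqrt (Finset.sum_le_sum fun i _ => ?_)
  rw [← PiLp.sub_apply, ← sq_abs, ← Real.norm_eq_abs]
  exact pow_le_pow_left₀ (norm_nonneg _) (PiLp.norm_apply_le _ b) 2

lemma netDist_triangle (Θ Γ Ξ : InnerParam l p) :
    netDist f x Θ Ξ ≤ netDist f x Θ Γ + netDist f x Γ Ξ := by
  let g : InnerParam l p → PiLp 2 (fun _ : Fin n => EuclideanSpace ℝ (Fin (p l))) := fun Θ =>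
    WithLp.toLp 2 fun i => innerNet f Θ (x i)
  have h : ∀ Θ Γ, netDist f x Θ Γ = ‖g Θ - g Γ‖ := fun Θ Γ => by
    rw [PiLp.norm_eq_of_L2]; rfl
  rw [h, h, h]
  exact norm_sub_le_norm_sub_add_norm_sub _ _ _

lemma netDist_comm (Θ Γ : InnerParam l p) : netDist f x Θ Γ = netDist f x Γ Θ := by
  simp only [netDist, norm_sub_rev]

/-- This lets the chain start from the single parameter 0, where the noise term vanishes. -/
lemma netDist_zero_le (hf : ∀ j, LipschitzWith 1 (f j)) (hf0 : ∀ j, f j 0 = 0) (hl : 0 < l)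
    {Θ : InnerParam l p} (hΘ : Θ ∈ nodeSet l p) : netDist f x Θ 0 ≤ inputSize x := by
  refine Real.sqrt_le_sqrt (Finset.sum_le_sum fun i _ => ?_)
  rw [innerNet_zero_param hf0 hl, sub_zero]
  exact pow_le_pow_left₀ (norm_nonneg _) (norm_innerNet_le hf hf0 hl hΘ _) 2

lemma abs_sum_mul_le_of_abs_le {w v : Fin n → ℝ} {U : ℝ} (hU : 0 ≤ U) (hv : ∀ i, |v i| ≤ U) :
    |∑ i, v i * w i| ≤ Real.sqrt n * U * Real.sqrt (∑ i, w i ^ 2) := by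
  have h1 : ∑ i, v i ^ 2 ≤ n * U ^ 2 := by
    refine (Finset.sum_le_card_nsmul _ _ (U ^ 2) fun i _ => ?_).trans (by simp)
    rw [← sq_abs]
    exact pow_le_pow_left₀ (abs_nonneg _) (hv i) 2
  refine abs_le_of_sq_le_sq ?_ (by positivity)
  rw [mul_pow, mul_pow, Real.sq_sqrt (Nat.cast_nonneg n), Real.sq_sqrt (by positivity)]
  exact (Finset.sum_mul_sq_le_sq_mul_sq _ _ _).trans
    (mul_le_mul_of_nonneg_right h1 (by positivity))

/-- Chaining along nets `S 0 = {0}, S 1, …, S T` for a fixed realization `v` of the noise. -/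
lemma abs_sum_mul_innerNet_le (hf0 : ∀ j, f j 0 = 0) (hl : 0 < l) {M : Set (InnerParam l p)}
    {S : ℕ → Finset (InnerParam l p)} (hS0 : S 0 = {0})
    (hS : ∀ t, ∀ Θ ∈ M, ∃ Γ ∈ S t, netDist f x Θ Γ ≤ inputSize x / 2 ^ t)
    {T : ℕ} (hT : (n : ℝ) ≤ 4 ^ T) {v : Fin n → ℝ} {U J : ℝ} (hU : 0 ≤ U) (hJ : 0 ≤ J)
    (hv : ∀ i, |v i| ≤ U) (b : Fin (p l))
    (hlink : ∀ t < T, ∀ Θ ∈ S t, ∀ Γ ∈ S (t + 1),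
      |∑ i, v i * (innerNet f Θ (x i) b - innerNet f Γ (x i) b)|
        ≤ 2 ^ t * J * Real.sqrt (∑ i, (innerNet f Θ (x i) b - innerNet f Γ (x i) b) ^ 2))
    {Θ : InnerParam l p} (hΘ : Θ ∈ M) :
    |∑ i, v i * innerNet f Θ (x i) b| ≤ inputSize x * (2 * T * J + U) := by
  set B := inputSize x
  have hB : 0 ≤ B := Real.sqrt_nonneg _
  choose π hπS hπ using fun t => hS t Θ hΘ
  have hstep : ∀ t < T, |∑ i, v i * (innerNet f (π t) (x i) b - innerNet f (π (t + 1)) (x i) b)|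
      ≤ 2 * J * B := by
    intro t ht
    refine (hlink t ht _ (hπS t) _ (hπS (t + 1))).trans ?_
    -- The 2^t of the link bound cancels here, so every scale contributes the same amount 2JB.
    have h1 : netDist f x (π t) (π (t + 1)) ≤ 2 * B / 2 ^ t := by
      refine (netDist_triangle _ Θ _).trans ?_
      rw [netDist_comm]
      have h2 : B / 2 ^ (t + 1) ≤ B / 2 ^ t :=
        div_le_div_of_nonneg_left hB (by positivity)
          (pow_le_pow_right₀ one_le_two (Nat.le_succ t))
      have h3 : 2 * B / 2 ^ t = B / 2 ^ t + B / 2 ^ t := by ring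
      linarith [hπ t, hπ (t + 1)]
    have h2 := (sqrt_sum_coord_le_netDist (f := f) (x := x) _ _ b).trans h1
    refine (mul_le_mul_of_nonneg_left h2 (by positivity)).trans_eq ?_
    field_simp
  have hchain : ∀ t ≤ T, |∑ i, v i * innerNet f (π t) (x i) b| ≤ t * (2 * J * B) := by
    intro t
    induction t with
    | zero =>
      intro _
      have h0 : π 0 = 0 := by
        have := hπS 0
        rwa [hS0, Finset.mem_singleton] at this
      simp [h0, innerNet_zero_param hf0 hl]
    | succ t ih =>
      intro ht
      have h1 := ih (Nat.le_of_succ_le ht)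
      have h2 := hstep t ht
      have h3 : ∑ i, v i * innerNet f (π (t + 1)) (x i) b
          = ∑ i, v i * innerNet f (π t) (x i) b
            - ∑ i, v i * (innerNet f (π t) (x i) b - innerNet f (π (t + 1)) (x i) b) := by
        rw [← Finset.sum_sub_distrib]
        exact Finset.sum_congr rfl fun i _ => by ring
      rw [h3]
      push_cast
      linarith [abs_sub (∑ i, v i * innerNet f (π t) (x i) b)
        (∑ i, v i * (innerNet f (π t) (x i) b - innerNet f (π (t + 1)) (x i) b))]
  -- Beyond the finest net the noise is bounded entrywise; 2^T ≥ sqrt n pays for Cauchy–Schwarz.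
  have hlast : |∑ i, v i * (innerNet f Θ (x i) b - innerNet f (π T) (x i) b)| ≤ U * B := by
    refine (abs_sum_mul_le_of_abs_le hU hv).trans ?_
    have h1 := (sqrt_sum_coord_le_netDist (f := f) (x := x) Θ (π T) b).trans (hπ T)
    have h2 : Real.sqrt n ≤ 2 ^ T := by
      refine Real.sqrt_le_iff.2 ⟨by positivity, hT.trans_eq ?_⟩
      rw [← pow_mul, mul_comm T 2, pow_mul]; norm_num
    calc Real.sqrt n * U * Real.sqrt (∑ i, (innerNet f Θ (x i) b - innerNet f (π T) (x i) b) ^ 2)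
        ≤ 2 ^ T * U * (B / 2 ^ T) :=
          mul_le_mul (mul_le_mul_of_nonneg_right h2 hU) h1 (Real.sqrt_nonneg _) (by positivity)
      _ = U * B := by field_simp
  have h1 : ∑ i, v i * innerNet f Θ (x i) b = ∑ i, v i * innerNet f (π T) (x i) b
      + ∑ i, v i * (innerNet f Θ (x i) b - innerNet f (π T) (x i) b) := by
    rw [← Finset.sum_add_distrib]
    exact Finset.sum_congr rfl fun i _ => by ring
  rw [h1]
  refine (abs_add_le _ _).trans ?_
  linarith [hchain T le_rfl]

end Chaining

lemma measureReal_biUnion_le_card_mul {Ω ι : Type*} [MeasurableSpace Ω] {P : Measure Ω}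
    (s : Finset ι) (A : ι → Set Ω) {ε : ℝ} (h : ∀ i ∈ s, P.real (A i) ≤ ε) :
    P.real (⋃ i ∈ s, A i) ≤ s.card * ε := by
  refine (measureReal_biUnion_finset_le s A).trans ?_
  simpa using Finset.sum_le_card_nsmul s _ ε h

lemma exp_neg_nat_mul_log {Q : ℕ} (hQ : 0 < Q) (k : ℕ) :
    Real.exp (-(k * Real.log Q)) = ((Q : ℝ) ^ k)⁻¹ := by
  rw [Real.exp_neg, Real.exp_nat_mul, Real.exp_log (Nat.cast_pos.2 hQ)]

/-- The chaining bound for the noise of a class of networks with small covering numbers. -/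
lemma one_sub_le_measureReal_noise_le {n l m q Q : ℕ} {p : ℕ → ℕ} {f : Activations l p}
    (hf : ∀ j, LipschitzWith 1 (f j)) (hf0 : ∀ j, f j 0 = 0) (hl : 0 < l) (hq : 0 < q)
    (hn : 0 < n) (hQ : 4 * n ≤ Q) (hmn : n * m ≤ Q) (hmp : m * p l ≤ Q)
    (x : Fin n → EuclideanSpace ℝ (Fin (p 0))) {M : Set (InnerParam l p)} (hM : M ⊆ nodeSet l p)
    (hnet : ∀ t : ℕ, ∃ S : Finset (InnerParam l p), ↑S ⊆ nodeSet l p ∧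
      S.card ≤ Q ^ (25604 * 4 ^ t * l * q) ∧
      ∀ Θ ∈ M, ∃ Γ ∈ S, netDist f x Θ Γ ≤ inputSize x / 2 ^ t)
    {Ω : Type*} [MeasurableSpace Ω] {P : Measure Ω} [IsProbabilityMeasure P]
    {u : Fin n → Ω → EuclideanSpace ℝ (Fin m)} (hu : ∀ i, Measurable (u i)) (hind : iIndepFun u P)
    (hmean : ∀ i a, ∫ ω, u i ω a ∂P = 0) {K σ : ℝ} (hK : 0 < K)
    (hsub : UniformlySubgaussian K σ P u) :
    1 - 1 / (n : ℝ) ≤ P.real {ω | ∀ Θ ∈ M, ∀ a b, |∑ i, u i ω a * innerNet f Θ (x i) b|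
      ≤ inputSize x * (2 * ⌈Real.log Q⌉₊ *
        Real.sqrt (2 * (K ^ 2 / 2 + 2 * σ ^ 2) * (128025 * (l * q * Real.log Q)))
        + K * Real.sqrt (4 * Real.log Q + σ ^ 2 / K ^ 2))} := by
  classical
  have hQ0 : 0 < Q := by omega
  have hQR : (1 : ℝ) ≤ Q := Nat.one_le_cast.2 hQ0
  set Λ := Real.log Q with hΛ
  have hΛ0 : 0 ≤ Λ := Real.log_nonneg hQR
  -- Large enough for 4^T ≥ Q ≥ n, yet at most `Q`, so that a union over scales is affordable.
  set T := ⌈Λ⌉₊ with hTdef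
  set τ : NNReal := Real.toNNReal (K ^ 2 / 2 + 2 * σ ^ 2) with hτdef
  have hτc : (τ : ℝ) = K ^ 2 / 2 + 2 * σ ^ 2 := Real.coe_toNNReal _ (by positivity)
  have hτ : 0 < τ := Real.toNNReal_pos.2 (by positivity)
  have hTn : (n : ℝ) ≤ 4 ^ T := by
    have h1 : (Q : ℝ) ≤ Real.exp T := by
      rw [← Real.exp_log (Nat.cast_pos.2 hQ0)]
      exact Real.exp_le_exp.2 (Nat.le_ceil _)
    have h2 : Real.exp T ≤ 4 ^ T := by
      rw [← Real.exp_one_pow]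
      exact pow_le_pow_left₀ (Real.exp_pos _).le (by linarith [Real.exp_one_lt_d9]) _
    have h3 : (n : ℝ) ≤ Q := Nat.cast_le.2 (by omega)
    linarith
  have hTQ : (T : ℝ) ≤ Q := by
    have h1 := (Nat.ceil_lt_add_one hΛ0).le
    have h2 := Real.log_le_sub_one_of_pos (Nat.cast_pos.2 hQ0 : (0 : ℝ) < Q)
    linarith
  choose S' hS'M hS'card hS' using hnet
  set S : ℕ → Finset (InnerParam l p) := fun t => if t = 0 then {0} else S' t with hSdef
  have hScard : ∀ t, (S t).card ≤ Q ^ (25604 * 4 ^ t * l * q) := by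
    intro t
    simp only [hSdef]
    split_ifs
    · simpa using Nat.one_le_pow _ _ hQ0
    · exact hS'card t
  have hScov : ∀ t, ∀ Θ ∈ M, ∃ Γ ∈ S t, netDist f x Θ Γ ≤ inputSize x / 2 ^ t := by
    intro t Θ hΘ
    simp only [hSdef]
    split_ifs with h
    · exact ⟨0, Finset.mem_singleton_self _, by
        simpa [h] using netDist_zero_le hf hf0 hl (hM hΘ)⟩
    · exact hS' t Θ hΘ
  -- Here 128025 = 25604(1 + 4) + 5: two consecutive nets, one power of `Q` for the pairs of
  -- coordinates, and four powers for the failure probability.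
  set J := Real.sqrt (2 * τ * (128025 * (l * q * Λ))) with hJdef
  set U := K * Real.sqrt (4 * Λ + σ ^ 2 / K ^ 2) with hUdef
  let w : InnerParam l p → InnerParam l p → Fin (p l) → Fin n → ℝ := fun Θ Γ b i =>
    innerNet f Θ (x i) b - innerNet f Γ (x i) b
  let bad : ℕ → (InnerParam l p × InnerParam l p) × (Fin m × Fin (p l)) → Set Ω := fun t k =>
    {ω | 2 ^ t * J * Real.sqrt (∑ i, w k.1.1 k.1.2 k.2.2 i ^ 2)
      < |∑ i, u i ω k.2.1 * w k.1.1 k.1.2 k.2.2 i|}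
  let large : Fin n × Fin m → Set Ω := fun k => {ω | U < |u k.1 ω k.2|}
  let I : ℕ → Finset ((InnerParam l p × InnerParam l p) × (Fin m × Fin (p l))) := fun t =>
    (S t ×ˢ S (t + 1)) ×ˢ Finset.univ
  have hJ : ∀ t : ℕ, 2 ^ t * J
      = Real.sqrt (2 * τ * ((128025 * 4 ^ t * l * q : ℕ) * Λ)) := by
    intro t
    have : (2 : ℝ) ^ t = Real.sqrt (4 ^ t) := by
      rw [show (4 : ℝ) ^ t = (2 ^ t) ^ 2 by rw [← pow_mul, mul_comm t 2, pow_mul]; norm_num,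
        Real.sqrt_sq (by positivity)]
    rw [this, hJdef, ← Real.sqrt_mul (by positivity)]
    congr 1
    push_cast; ring
  have hmgf : ∀ i a, HasSubgaussianMGF (fun ω => u i ω a) τ P := fun i a =>
    hasSubgaussianMGF_of_exp_sq hK (by fun_prop)
      (hsub i a).1 (hmean i a) (hsub i a).2
  have hinda : ∀ a, iIndepFun (fun i ω => u i ω a) P := fun a =>
    hind.comp (fun _ z => z a) fun _ => by fun_prop
  have hbad : ∀ t k, P.real (bad t k) ≤ 2 * ((Q : ℝ) ^ (128025 * 4 ^ t * l * q))⁻¹ := by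
    intro t k
    have := measureReal_lt_abs_sum_le (hinda k.2.1) (fun i => hmgf i k.2.1) hτ
      (w k.1.1 k.1.2 k.2.2) (y := (128025 * 4 ^ t * l * q : ℕ) * Λ) (by positivity)
    rwa [← hJ, exp_neg_nat_mul_log hQ0] at this
  have hlarge : ∀ k, P.real (large k) ≤ ((Q : ℝ) ^ 4)⁻¹ := by
    intro k
    have := measureReal_lt_abs_le hK (hsub k.1 k.2).1 (hsub k.1 k.2).2 ((4 : ℕ) * Λ)
      (by positivity)
    rw [exp_neg_nat_mul_log hQ0] at this
    exact this
  have hcardI : ∀ t, ((I t).card : ℝ) * (2 * ((Q : ℝ) ^ (128025 * 4 ^ t * l * q))⁻¹)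
      ≤ 2 * ((Q : ℝ) ^ 4)⁻¹ := by
    intro t
    have h1 : (I t).card * Q ^ 4 ≤ Q ^ (128025 * 4 ^ t * l * q) := by
      simp only [I, Finset.card_product, Finset.card_univ, Fintype.card_prod, Fintype.card_fin]
      calc (S t).card * (S (t + 1)).card * (m * p l) * Q ^ 4
          ≤ Q ^ (25604 * 4 ^ t * l * q) * Q ^ (25604 * 4 ^ (t + 1) * l * q) * Q * Q ^ 4 := by
            gcongr
            · exact hScard t
            · exact hScard (t + 1)
        _ = Q ^ (25604 * 4 ^ t * l * q + 25604 * 4 ^ (t + 1) * l * q + 5) := by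
            rw [pow_add, pow_add]; ring
        _ ≤ Q ^ (128025 * 4 ^ t * l * q) := by
            refine Nat.pow_le_pow_right hQ0 ?_
            have h2 : 0 < 4 ^ t * l * q := by positivity
            have h3 : 25604 * 4 ^ t * l * q = 25604 * (4 ^ t * l * q) := by ring
            have h4 : 25604 * 4 ^ (t + 1) * l * q = 102416 * (4 ^ t * l * q) := by ring
            have h5 : 128025 * 4 ^ t * l * q = 128025 * (4 ^ t * l * q) := by ring
            omega
    have h2 : ((I t).card : ℝ) * (Q : ℝ) ^ 4 ≤ (Q : ℝ) ^ (128025 * 4 ^ t * l * q) := by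
      exact_mod_cast h1
    have hQpos : (0 : ℝ) < Q := by linarith
    rw [mul_left_comm]
    refine mul_le_mul_of_nonneg_left ?_ zero_le_two
    rw [mul_inv_le_iff₀ (by positivity), inv_mul_eq_div, le_div_iff₀ (by positivity)]
    exact h2
  set Bad : Set Ω := (⋃ t ∈ Finset.range T, ⋃ k ∈ I t, bad t k) ∪ ⋃ k ∈ Finset.univ, large k
    with hBad
  have hBadP : P.real Bad ≤ 1 / n := by
    have h1 := measureReal_biUnion_le_card_mul (P := P) (Finset.range T)
      (fun t => ⋃ k ∈ I t, bad t k) (fun t _ =>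
        (measureReal_biUnion_le_card_mul (I t) (bad t) fun k _ => hbad t k).trans (hcardI t))
    have h2 := measureReal_biUnion_le_card_mul (P := P) Finset.univ large fun k _ => hlarge k
    rw [Finset.card_range] at h1
    rw [Finset.card_univ, Fintype.card_prod, Fintype.card_fin, Fintype.card_fin] at h2
    have h3 : ((n * m : ℕ) : ℝ) ≤ Q := Nat.cast_le.2 hmn
    have hQpos : (0 : ℝ) < Q := by linarith
    have h4 : 0 < ((Q : ℝ) ^ 4)⁻¹ := by positivity
    -- At most `Q` scales fail with probability at most 2/Q⁴ each, and at most `Q` noise entries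
    -- exceed `U` with probability at most 1/Q⁴ each.
    have h5 : P.real Bad ≤ 3 * (Q * ((Q : ℝ) ^ 4)⁻¹) := by
      refine (measureReal_union_le _ _).trans ?_
      nlinarith
    refine h5.trans ?_
    have hnR : (0 : ℝ) < n := Nat.cast_pos.2 hn
    have h6 : (4 : ℝ) * n ≤ Q := by exact_mod_cast hQ
    have h7 : (Q : ℝ) * ((Q : ℝ) ^ 4)⁻¹ = ((Q : ℝ) ^ 3)⁻¹ := by field_simp
    rw [h7, ← div_eq_mul_inv, div_le_div_iff₀ (by positivity) hnR]
    have h8 : (Q : ℝ) ≤ Q ^ 3 := le_self_pow₀ hQR (by norm_num)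
    linarith
  have hgood : Badᶜ ⊆ {ω | ∀ Θ ∈ M, ∀ a b, |∑ i, u i ω a * innerNet f Θ (x i) b|
      ≤ inputSize x * (2 * T * J + U)} := by
    intro ω hω Θ hΘ a b
    simp only [hBad, Set.mem_compl_iff, Set.mem_union, not_or, Set.mem_iUnion, not_exists] at hω
    refine abs_sum_mul_innerNet_le hf0 hl (by simp [hSdef]) hScov hTn (by positivity)
      (Real.sqrt_nonneg _) (fun i => ?_) b (fun t ht Ξ hΞ Γ hΓ => ?_) hΘ
    · exact not_lt.1 (hω.2 (i, a) (Finset.mem_univ _))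
    · refine not_lt.1 (hω.1 t (Finset.mem_range.2 ht) ((Ξ, Γ), (a, b)) ?_)
      exact Finset.mem_product.2 ⟨Finset.mem_product.2 ⟨hΞ, hΓ⟩, Finset.mem_univ _⟩
  rw [← hτc]
  refine le_trans ?_ (measureReal_mono hgood)
  -- Subadditivity avoids any measurability question.
  have h1 : (1 : ℝ) ≤ P.real Bad + P.real Badᶜ := by
    have := measureReal_union_le (μ := P) Bad Badᶜ
    rwa [Set.union_compl_self, probReal_univ] at this
  linarith

end SparseNet

/-! ### From the chaining bound to the stated form. -/

namespace SparseNet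

section Inputs

variable {n d : ℕ}

lemma inputSize_eq (hn : 0 < n) (x : Fin n → EuclideanSpace ℝ (Fin d)) :
    inputSize x = Real.sqrt n * vInf x := by
  have hnR : (0 : ℝ) < n := Nat.cast_pos.2 hn
  rw [inputSize, vInf, ← Real.sqrt_mul hnR.le]
  congr 1
  field_simp

lemma vInf_le_vTwo (x : Fin n → EuclideanSpace ℝ (Fin d)) : vInf x ≤ vTwo x := by
  refine Real.sqrt_le_sqrt (mul_le_mul_of_nonneg_left
    (Finset.sum_le_sum fun i _ => pow_le_pow_left₀ (norm_nonneg _) ?_ 2) (by positivity))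
  exact (pi_norm_le_iff_of_nonneg (norm_nonneg _)).2 fun k => PiLp.norm_apply_le (x i) k

end Inputs

lemma normMax_le {a b : ℕ} {A : Matrix (Fin a) (Fin b) ℝ} {r : ℝ} (hr : 0 ≤ r)
    (h : ∀ i k, |A i k| ≤ r) : normMax A ≤ r :=
  Real.iSup_le (fun i => Real.iSup_le (h i) hr) hr

lemma noiseMatrix_apply {n l m : ℕ} {p : ℕ → ℕ} (f : Activations l p)
    (x : Fin n → EuclideanSpace ℝ (Fin (p 0))) (u : Fin n → EuclideanSpace ℝ (Fin m))
    (Θ : InnerParam l p) (a : Fin m) (b : Fin (p l)) :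
    noiseMatrix f x u Θ a b = ∑ i, u i a * innerNet f Θ (x i) b := by
  simp [noiseMatrix, Matrix.sum_apply, Matrix.vecMulVec_apply]

/-- The numerical simplification of the chaining bound. -/
lemma chaining_bound_le {K σ Λ L : ℝ} (hK : 0 < K) (hΛ : 1 ≤ Λ) (hL : 1 ≤ L) :
    2 * ⌈Λ⌉₊ * Real.sqrt (2 * (K ^ 2 / 2 + 2 * σ ^ 2) * (128025 * (L * Λ)))
        + K * Real.sqrt (4 * Λ + σ ^ 2 / K ^ 2)
      ≤ (4 * Real.sqrt (2 * (K ^ 2 / 2 + 2 * σ ^ 2) * 128025)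
          + K * Real.sqrt (4 + σ ^ 2 / K ^ 2)) * Real.sqrt (L * Λ ^ 3) := by
  have hT : (⌈Λ⌉₊ : ℝ) ≤ 2 * Λ := by
    linarith [(Nat.ceil_lt_add_one (by linarith : (0 : ℝ) ≤ Λ)).le]
  have h0 : 0 ≤ L * Λ := by positivity
  have hs : Real.sqrt (L * Λ ^ 3) = Λ * Real.sqrt (L * Λ) := by
    rw [show L * Λ ^ 3 = Λ ^ 2 * (L * Λ) by ring, Real.sqrt_mul (by positivity),
      Real.sqrt_sq (by positivity)]
  have h1 : Real.sqrt (2 * (K ^ 2 / 2 + 2 * σ ^ 2) * (128025 * (L * Λ)))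
      = Real.sqrt (2 * (K ^ 2 / 2 + 2 * σ ^ 2) * 128025) * Real.sqrt (L * Λ) := by
    rw [← mul_assoc, Real.sqrt_mul (by positivity)]
  have h2 : Real.sqrt (4 * Λ + σ ^ 2 / K ^ 2)
      ≤ Real.sqrt (4 + σ ^ 2 / K ^ 2) * Real.sqrt (L * Λ ^ 3) := by
    rw [← Real.sqrt_mul (by positivity)]
    refine Real.sqrt_le_sqrt ?_
    have hd : 0 ≤ σ ^ 2 / K ^ 2 := by positivity
    have h3 : Λ ≤ L * Λ ^ 3 := by
      have := le_self_pow₀ hΛ (by norm_num : 3 ≠ 0)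
      exact this.trans (le_mul_of_one_le_left (by positivity) hL)
    nlinarith
  rw [add_mul]
  refine add_le_add ?_ ?_
  · rw [h1, hs]
    have := mul_le_mul_of_nonneg_right hT
      (by positivity : 0 ≤ 2 * (Real.sqrt (2 * (K ^ 2 / 2 + 2 * σ ^ 2) * 128025)
        * Real.sqrt (L * Λ)))
    linarith
  · rw [mul_assoc]
    exact mul_le_mul_of_nonneg_left h2 hK.le

lemma iSup_normMax_noiseMatrix_le {n l m : ℕ} {p : ℕ → ℕ} {f : Activations l p}
    {x : Fin n → EuclideanSpace ℝ (Fin (p 0))} {u : Fin n → EuclideanSpace ℝ (Fin m)}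
    {M : Set (InnerParam l p)} {r : ℝ} (hr : 0 ≤ r)
    (h : ∀ Θ ∈ M, ∀ a b, |∑ i, u i a * innerNet f Θ (x i) b| ≤ r) :
    ⨆ Θ ∈ M, ENNReal.ofReal (normMax (noiseMatrix f x u Θ)) ≤ ENNReal.ofReal r :=
  iSup₂_le fun Θ hΘ => ENNReal.ofReal_le_ofReal <| normMax_le hr fun a b => by
    rw [noiseMatrix_apply]
    exact h Θ hΘ a b

end SparseNet

theorem proposition2 (K σ₀ : ℝ) (hK : 0 < K) (hσ₀ : 0 < σ₀) :
    ∃ c : ℝ, 0 < c ∧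
      ∀ (n l m : ℕ) (p : ℕ → ℕ) (f : SparseNet.Activations l p)
        (x : Fin n → EuclideanSpace ℝ (Fin (p 0)))
        (Ω : Type*) [MeasurableSpace Ω] (P : Measure Ω) [IsProbabilityMeasure P]
        (u : Fin n → Ω → EuclideanSpace ℝ (Fin m)),
        0 < n → 0 < l → p (l + 1) = m → (∀ j ≤ l + 1, 0 < p j) →
        (∀ j, LipschitzWith 1 (f j)) → (∀ j, f j 0 = 0) →
        (∀ i, Measurable (u i)) → iIndepFun u P →
        (∀ i a, ∫ ω, u i ω a ∂P = 0) →
        SparseNet.UniformlySubgaussian K σ₀ P u →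
        1 - 1 / (n : ℝ) ≤ P.real {ω | SparseNet.rCon f x (fun i => u i ω) ≤
            ENNReal.ofReal (c * SparseNet.vInf x *
              Real.sqrt ((n : ℝ) * l *
                (Real.log (2 * (m : ℝ) * n * (SparseNet.numParams l p : ℝ))) ^ 3))} ∧
        1 - 1 / (n : ℝ) ≤ P.real {ω | SparseNet.rNode f x (fun i => u i ω) ≤
            ENNReal.ofReal (c * SparseNet.vTwo x *
              Real.sqrt ((m : ℝ) * n * l * (SparseNet.maxWidth l p : ℝ) *
                (Real.log (2 * (m : ℝ) * n * (SparseNet.numParams l p : ℝ))) ^ 3))} := by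
  open SparseNet in
  set c₀ := 4 * Real.sqrt (2 * (K ^ 2 / 2 + 2 * σ₀ ^ 2) * 128025)
    + K * Real.sqrt (4 + σ₀ ^ 2 / K ^ 2) with hc₀
  have hc₀pos : 0 < c₀ := by positivity
  refine ⟨2 * c₀, by positivity, ?_⟩
  intro n l m p f x Ω _ P _ u hn hl hm hp hf hf0 hu hind hmean hsub
  -- For n = 1 the claimed probability is 0. For n ≥ 2, both mn and the number of parameters are at
  -- least 2, which yields every lower bound on `Q` used below and `1 ≤ Λ`.
  rcases (Nat.one_le_iff_ne_zero.2 hn.ne').eq_or_lt with rfl | hn2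
  · simp
  set Q := 2 * m * n * numParams l p with hQdef
  have hm0 : 0 < m := hm ▸ hp (l + 1) le_rfl
  have hN := succ_le_numParams hp
  have hmn0 : 2 ≤ m * n := by nlinarith
  have hQN : 4 * numParams l p ≤ Q := by
    have := Nat.mul_le_mul_right (numParams l p) (Nat.mul_le_mul_left 2 hmn0)
    rw [hQdef, mul_assoc 2 m n]; omega
  have hmp : m * p l ≤ Q := by
    have := mul_le_numParams (p := p) (le_refl l)
    rw [hm] at this; omega
  have hmnQ : 2 * (2 * (m * n)) ≤ Q := by
    rw [hQdef, mul_assoc 2 m n, mul_comm 2 (2 * (m * n))]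
    exact Nat.mul_le_mul_left _ (by omega)
  have hnmn : n ≤ m * n := Nat.le_mul_of_pos_left n hm0
  have hQn : 4 * n ≤ Q := by omega
  have hnm : n * m ≤ Q := by rw [mul_comm]; omega
  have hlog : Real.log (2 * (m : ℝ) * n * (numParams l p : ℝ)) = Real.log Q := by
    rw [hQdef]; push_cast; rfl
  set Λ := Real.log Q with hΛ
  have hΛ1 : 1 ≤ Λ := by
    rw [hΛ, Real.le_log_iff_exp_le (Nat.cast_pos.2 (by omega))]
    have : (8 : ℝ) ≤ Q := by exact_mod_cast (by omega : 8 ≤ Q)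
    linarith [Real.exp_one_lt_d9]
  have hlR : (1 : ℝ) ≤ l := Nat.one_le_cast.2 hl
  have hB := inputSize_eq hn x
  have hB0 : 0 ≤ inputSize x := Real.sqrt_nonneg _
  rw [hlog]
  constructor
  · have hmain := one_sub_le_measureReal_noise_le hf hf0 hl one_pos hn hQn hnm hmp x
      (conSet_subset_nodeSet l p) (exists_net_conSet hf hf0 hl hp hQN x) hu hind hmean hK hsub
    refine hmain.trans (measureReal_mono fun ω hω => ?_)
    have hbound := chaining_bound_le (σ := σ₀) hK hΛ1 (L := (l : ℝ) * (1 : ℕ)) (by simpa using hlR)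
    have hsup := iSup_normMax_noiseMatrix_le (by positivity) hω
    refine (mul_le_mul_right hsup 2).trans ?_
    rw [← ENNReal.ofReal_ofNat 2, ← ENNReal.ofReal_mul zero_le_two]
    refine ENNReal.ofReal_le_ofReal ?_
    have h1 : Real.sqrt ((n : ℝ) * l * Λ ^ 3)
        = Real.sqrt n * Real.sqrt ((l : ℝ) * (1 : ℕ) * Λ ^ 3) := by
      rw [← Real.sqrt_mul (Nat.cast_nonneg n)]; congr 1; push_cast; ring
    rw [h1]
    have h2 := mul_le_mul_of_nonneg_left hbound (mul_nonneg zero_le_two hB0)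
    rw [hB] at h2 ⊢
    linarith
  · have hmain := one_sub_le_measureReal_noise_le hf hf0 hl (maxWidth_pos hl hp) hn hQn hnm hmp x
      subset_rfl (exists_net_nodeSet hf hf0 hl hp hQN x) hu hind hmean hK hsub
    refine hmain.trans (measureReal_mono fun ω hω => ?_)
    have hwR : (1 : ℝ) ≤ maxWidth l p := Nat.one_le_cast.2 (maxWidth_pos hl hp)
    have hbound := chaining_bound_le (σ := σ₀) hK hΛ1 (L := (l : ℝ) * maxWidth l p)
      (one_le_mul_of_one_le_of_one_le hlR hwR)
    have hsup := iSup_normMax_noiseMatrix_le (by positivity) hω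
    refine (mul_le_mul_right hsup _).trans ?_
    rw [← ENNReal.ofReal_ofNat 2, ← ENNReal.ofReal_mul zero_le_two,
      ← ENNReal.ofReal_mul (by positivity)]
    refine ENNReal.ofReal_le_ofReal ?_
    have h1 : Real.sqrt ((m : ℝ) * n * l * maxWidth l p * Λ ^ 3)
        = Real.sqrt m * (Real.sqrt n * Real.sqrt ((l : ℝ) * maxWidth l p * Λ ^ 3)) := by
      rw [← Real.sqrt_mul (Nat.cast_nonneg n), ← Real.sqrt_mul (Nat.cast_nonneg m)]
      congr 1; ring
    rw [h1]
    have h2 := mul_le_mul_of_nonneg_left hbound hB0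
    -- The chaining bound holds with maximum norms here too; only now is it weakened to Euclidean
    -- norms.
    have h3 : inputSize x ≤ Real.sqrt n * vTwo x := by
      rw [hB]
      exact mul_le_mul_of_nonneg_left (vInf_le_vTwo x) (Real.sqrt_nonneg _)
    have h4 := h2.trans (mul_le_mul_of_nonneg_right h3 (by positivity))
    refine (mul_le_mul_of_nonneg_left h4 (by positivity)).trans_eq ?_
    ring
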